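/- **Definitions.** A *Lorenz map* on $I=[u_0,v_0]$ with discontinuity $c\in(u_0,v_0)$ is a map $f: I\setminus\{c\}\to I$ that is continuous and strictly increasing on $[u_0,c)$ and on $(c,v_0]$, with $f(c_-)=v_0$ and $f(c_+)=u_0$ (one-sided limits). Since $f$ is not defined at $c$, an iterate $f^n$ is defined at $x$ only if $x,f(x),\dots,f^{n-1}(x)\neq c$. For $0<c<1$ put $$f_{a,b,c}(x)=ax+1-ac\quad(0\le x<c),\qquad f_{a,b,c}(x)=b(x-c)\quad(c<x\le 1),$$ and let $\mathcal L$ be the set of those $f_{a,b,c}$ that are Lorenz maps on $[0,1]$ and expand on average, i.e. $ac+b(1-c)>1$. Let $f$ be a Lorenz map on $I=[u_0,v_0]$. A *proper completely invariant closed set* of $f$ is a nonempty closed set $E\subset(u_0,v_0)\setminus\{c\}$ with $f(E)=E$ and $\{x\in(u_0,v_0)\setminus\{c\}: f(x)\in E\}=E$. The completely invariant closed sets are these sets and $I$ itself; the *minimal* one is the one contained in all of them. A *minimal-period orbit* $O$ is the orbit of a periodic point in $I\setminus\{c\}$ whose period is the smallest among the periods of all periodic points. A *renormalization* of $f$ is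 a Lorenz map $g$ on a proper subinterval $[u,v]\ni c$ of $I$, $g=f^{\ell}$ on $[u,c)$, $g=f^{r}$ on $(c,v]$, with $\ell,r>1$, that is associated with a proper completely invariant closed set $E$: $\ell$ and $r$ are the maximal integers such that $f^\ell$ is defined and continuous on $(e_-,c)$ and $f^r$ on $(c,e_+)$, where $e_-=\sup\{x\in E:x<c\}$, $e_+=\inf\{x\in E:x>c\}$. If $f$ has no renormalization it is *prime*. The renormalization $Rf=(f^\ell,f^r)$ is the *minimal* one if $\ell\le\ell'$ and $r\le r'$ for every renormalization $(f^{\ell'},f^{r'})$ of $f$. Put $R^0f=f$ and $R^{i}f=R(R^{i-1}f)$ as long as this exists; $f$ is *$m$ times renormalizable* if $R^1f,\dots,R^mf$ exist and $R^mf$ is prime. The renormalization $R^if$ is *periodic* if $R^{i-1}f$ has exactly one minimal-period orbit $O$, and $O$ is the minimal completely invariant closed set of $R^{i-1}f$. **Theorem.** Let $f\in\mathcal L$. 1. $f$ is finitely renormalizable: there is a finite $m\ge 0$ such that $f$ is $m$ times renormalizable, and the renormalization process cannot be carried out more than $m$ times. 2. Each renormalization $R^if$, $1\le i\le m$, is periodic.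 3. (Dichotomy.) $f$ has a minimal-period orbit and a minimal completely invariant closed set $D$, and for every minimal-period orbit $O$ either $D=O$ or $D=[0,1]$. If the minimal period is greater than $1$, then $D$ is the closure of $\bigcup_{n\ge0}\{x\in(0,1): f^n(x)\text{ is defined and lies in }O\}$. -/

import Mathlib

open Set Filter Topology

/-- The data of an interval map `[left, right] → [left, right]` with one exceptional point `crit`.
The value of `map` at `crit` and outside `[left, right]` carries no meaning and is never used. -/
structure LorenzData where
  left : ℝ
  right : ℝ
  crit : ℝ
  map : ℝ → ℝ

namespace LorenzData

/-- `f` is a Lorenz map on `[left, right]` with discontinuity `crit`. -/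
structure IsLorenz (f : LorenzData) : Prop where
  left_lt : f.left < f.crit
  lt_right : f.crit < f.right
  continuousOn_left : ContinuousOn f.map (Ico f.left f.crit)
  continuousOn_right : ContinuousOn f.map (Ioc f.crit f.right)
  strictMonoOn_left : StrictMonoOn f.map (Ico f.left f.crit)
  strictMonoOn_right : StrictMonoOn f.map (Ioc f.crit f.right)
  mapsTo : MapsTo f.map (Icc f.left f.right \ {f.crit}) (Icc f.left f.right)
  tendsto_left : Tendsto f.map (𝓝[<] f.crit) (𝓝 f.right)
  tendsto_right : Tendsto f.map (𝓝[>] f.crit) (𝓝 f.left)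

/-- The `n`-th iterate of `f` is defined (no point of `S` meets `crit` before time `n`) and
continuous on `S`. -/
def IterContOn (f : LorenzData) (n : ℕ) (S : Set ℝ) : Prop :=
  (∀ x ∈ S, ∀ i < n, f.map^[i] x ≠ f.crit) ∧ ContinuousOn f.map^[n] S

/-- `x` is a periodic point of `f` (its orbit never meets `crit`). -/
def IsPeriodicPoint (f : LorenzData) (x : ℝ) : Prop :=
  x ∈ Icc f.left f.right ∧ (∀ i, f.map^[i] x ≠ f.crit) ∧ x ∈ Function.periodicPts f.map

/-- `O` is a periodic orbit of `f` whose period is minimal among the periods of all periodic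
points. -/
def IsMinPeriodOrbit (f : LorenzData) (O : Set ℝ) : Prop :=
  ∃ x, f.IsPeriodicPoint x ∧ O = range (fun i : ℕ => f.map^[i] x) ∧
    ∀ y, f.IsPeriodicPoint y → Function.minimalPeriod f.map x ≤ Function.minimalPeriod f.map y

/-- The closure of the union of all the iterated preimages `f⁻ⁿ(O)`, `n ≥ 0`, the preimages being
taken in the open interval. -/
def preimageClosure (f : LorenzData) (O : Set ℝ) : Set ℝ :=
  closure {x | x ∈ Ioo f.left f.right ∧
    ∃ n : ℕ, (∀ i < n, f.map^[i] x ≠ f.crit) ∧ f.map^[n] x ∈ O}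

/-- `E` is a proper (and nonempty) completely invariant closed set: `f(E) = f⁻¹(E) = E`, where `f`
acts on the open interval without `crit`. -/
structure IsProperCompletelyInvariant (f : LorenzData) (E : Set ℝ) : Prop where
  nonempty : E.Nonempty
  isClosed : IsClosed E
  subset : E ⊆ Ioo f.left f.right \ {f.crit}
  image_eq : f.map '' E = E
  preimage_eq : {x | x ∈ Ioo f.left f.right \ {f.crit} ∧ f.map x ∈ E} = E

/-- A completely invariant closed set is a proper one or the whole interval. -/
def IsCompletelyInvariant (f : LorenzData) (E : Set ℝ) : Prop :=
  E = Icc f.left f.right ∨ f.IsProperCompletelyInvariant E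

/-- `D` is the minimal (that is, the least) completely invariant closed set of `f`. -/
def IsMinimalCompletelyInvariant (f : LorenzData) (D : Set ℝ) : Prop :=
  f.IsCompletelyInvariant D ∧ ∀ E, f.IsCompletelyInvariant E → D ⊆ E

/-- The map `(f^ℓ, f^r)` on `[u, v]`. -/
noncomputable def glue (f : LorenzData) (ℓ r : ℕ) (u v : ℝ) : LorenzData where
  left := u
  right := v
  crit := f.crit
  map := fun x => if x < f.crit then f.map^[ℓ] x else f.map^[r] x

/-- `ℓ` and `r` are the maximal integers such that `f^ℓ` and `f^r` are continuous on `(e₋, crit)`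
and `(crit, e₊)`, where `e₋ = sup {x ∈ E : x < crit}` and `e₊ = inf {x ∈ E : x > crit}`. -/
def HasReturnTimes (f : LorenzData) (E : Set ℝ) (ℓ r : ℕ) : Prop :=
  ∃ p q : ℝ, IsLUB (E ∩ Iio f.crit) p ∧ IsGLB (E ∩ Ioi f.crit) q ∧
    IsGreatest {n : ℕ | f.IterContOn n (Ioo p f.crit)} ℓ ∧
    IsGreatest {n : ℕ | f.IterContOn n (Ioo f.crit q)} r

/-- `g = (f^ℓ, f^r)` is a renormalization of `f`: `ℓ, r > 1`, `g` is a Lorenz map on a proper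
subinterval `[u, v]` around `crit`, and `g` is associated with a proper completely invariant closed
set of `f`. -/
def IsRenormalization (f : LorenzData) (ℓ r : ℕ) (g : LorenzData) : Prop :=
  1 < ℓ ∧ 1 < r ∧
  ∃ u v : ℝ, f.left ≤ u ∧ v ≤ f.right ∧ (u ≠ f.left ∨ v ≠ f.right) ∧
    f.IterContOn ℓ (Ico u f.crit) ∧ f.IterContOn r (Ioc f.crit v) ∧
    g = f.glue ℓ r u v ∧ g.IsLorenz ∧
    ∃ E, f.IsProperCompletelyInvariant E ∧ f.HasReturnTimes E ℓ r

/-- `f` is prime: it has no renormalization. -/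
def IsPrime (f : LorenzData) : Prop :=
  ¬ ∃ ℓ r g, f.IsRenormalization ℓ r g

/-- `g = R f` is the minimal renormalization of `f`. -/
def IsMinimalRenormalization (f g : LorenzData) : Prop :=
  ∃ ℓ r, f.IsRenormalization ℓ r g ∧
    ∀ ℓ' r' g', f.IsRenormalization ℓ' r' g' → ℓ ≤ ℓ' ∧ r ≤ r'

/-- `F 0 = f, F 1 = R f, …, F k = R^k f`: the renormalization process of `f` proceeds (at least)
`k` times. -/
def IsRenormalizationChain (f : LorenzData) (k : ℕ) (F : ℕ → LorenzData) : Prop :=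
  F 0 = f ∧ ∀ i < k, (F i).IsMinimalRenormalization (F (i + 1))

/-- The renormalization process of `f` proceeds exactly `m` times and then stops at a prime map. -/
def IsTimesRenormalizable (f : LorenzData) (m : ℕ) : Prop :=
  ∃ F, f.IsRenormalizationChain m F ∧ (F m).IsPrime

/-- `f` has exactly one periodic orbit `O` of minimal period, and the minimal completely invariant
closed set of `f` is `O`. The minimal renormalization of `f` is periodic when this holds. -/
def MinimalRenormalizationIsPeriodic (f : LorenzData) : Prop :=
  ∃ O, f.IsMinPeriodOrbit O ∧ (∀ O', f.IsMinPeriodOrbit O' → O' = O) ∧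
    f.IsMinimalCompletelyInvariant O

/-- The piecewise linear map `f_{a,b,c}` on `[0, 1]`. -/
noncomputable def pwLinear (a b c : ℝ) : LorenzData where
  left := 0
  right := 1
  crit := c
  map := fun x => if x < c then a * x + 1 - a * c else b * (x - c)

end LorenzData

/-!
For a piecewise linear Lorenz map `f` that expands on average there is an affine weight `ψ > 0` such
that `ψ (f x) ≤ slope x * ψ x - δ` with `δ > 0`; hence the slopes of the iterates tend to infinity,
and `f` behaves like an expanding map although one of its slopes may be less than `1`.

Let `E` be a proper completely invariant closed set, and `x`, `y` its points next to the critical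
point. They are periodic, say of periods `ℓ` and `r`, and since `(x, y)` is a gap of `E`, the maps
`f^ℓ` on `(x, crit)` and `f^r` on `(crit, y)` stay in `(x, y)`. So their slopes `A`, `B` satisfy
`1/A + 1/B ≥ 1`. If the orbit of `x` stayed away from the least point of `E`, some interval would
have two disjoint preimages inside itself, of relative lengths `1/A` and `1/B`: a contradiction.
Hence this orbit passes through both extreme points of `E`, which isolates its points in `E`, and a
minimal `E` is a single periodic orbit. It is unique, and its period is the least one.

A renormalization is again piecewise linear, with slopes `A, B > 1`. The next renormalizations have
at least the squares of these slopes, and no piecewise linear Lorenz map has two slopes above `2`.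
-/

namespace LorenzData

section Itineraries

variable {f : LorenzData} {m n : ℕ} {t u w z : ℝ}

/-- `z` and `w` lie on the same branch of `f`; the critical point lies on none. -/
def SameSide (f : LorenzData) (z w : ℝ) : Prop :=
  (z < f.crit ∧ w < f.crit) ∨ (f.crit < z ∧ f.crit < w)

/-- The itineraries of `z` and `w` agree up to time `n` (excluded). In particular neither orbit
meets the critical point before time `n`. -/
def SameItin (f : LorenzData) (n : ℕ) (z w : ℝ) : Prop :=
  ∀ i < n, f.SameSide (f.map^[i] z) (f.map^[i] w)

lemma sameSide_self : f.SameSide z z ↔ z ≠ f.crit := by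
  rw [SameSide, and_self, and_self, ne_iff_lt_or_gt]

lemma SameSide.symm (h : f.SameSide z w) : f.SameSide w z :=
  h.imp And.symm And.symm

lemma SameSide.trans (h : f.SameSide z u) (h' : f.SameSide u w) : f.SameSide z w := by
  unfold SameSide at *
  grind

lemma SameSide.ne_crit (h : f.SameSide z w) : z ≠ f.crit :=
  sameSide_self.1 (h.trans h.symm)

lemma SameSide.of_mem_Icc (h : f.SameSide z w) (hu : u ∈ Icc z w) : f.SameSide z u := by
  unfold SameSide at *
  grind

lemma not_sameSide_iff (h : z ≤ w) : ¬ f.SameSide z w ↔ f.crit ∈ Icc z w := by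
  unfold SameSide
  grind

lemma SameItin.zero (z w : ℝ) : f.SameItin 0 z w :=
  fun _ hi => absurd hi (Nat.not_lt_zero _)

lemma sameItin_one : f.SameItin 1 z w ↔ f.SameSide z w := by
  simp [SameItin]

lemma SameItin.symm (h : f.SameItin n z w) : f.SameItin n w z :=
  fun i hi => (h i hi).symm

lemma SameItin.trans (h : f.SameItin n z u) (h' : f.SameItin n u w) : f.SameItin n z w :=
  fun i hi => (h i hi).trans (h' i hi)

lemma SameItin.mono (h : f.SameItin n z w) (hmn : m ≤ n) : f.SameItin m z w :=
  fun i hi => h i (hi.trans_le hmn)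

lemma SameItin.ne_crit (h : f.SameItin n z w) : ∀ i < n, f.map^[i] z ≠ f.crit :=
  fun i hi => (h i hi).ne_crit

lemma SameItin.succ (h : f.SameItin n z w) (h' : f.SameSide (f.map^[n] z) (f.map^[n] w)) :
    f.SameItin (n + 1) z w :=
  fun i hi => (Nat.lt_succ_iff_lt_or_eq.1 hi).elim (h i) fun e => e ▸ h'

lemma SameItin.add (h : f.SameItin m z w) (h' : f.SameItin n (f.map^[m] z) (f.map^[m] w)) :
    f.SameItin (n + m) z w := by
  intro i hi
  rcases lt_or_ge i m with him | him
  · exact h i him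
  · obtain ⟨j, rfl⟩ := Nat.exists_eq_add_of_le' him
    rw [Function.iterate_add_apply, Function.iterate_add_apply]
    exact h' j (by omega)

lemma SameItin.iterate (h : f.SameItin (n + m) z w) : f.SameItin n (f.map^[m] z) (f.map^[m] w) := by
  intro i hi
  rw [← Function.iterate_add_apply, ← Function.iterate_add_apply]
  exact h (i + m) (by omega)

/-! ### Order and continuity along itineraries -/

namespace IsLorenz

variable (hf : f.IsLorenz)
include hf

lemma left_lt_right : f.left < f.right := hf.left_lt.trans hf.lt_right

lemma left_mem : f.left ∈ Icc f.left f.right := left_mem_Icc.2 hf.left_lt_right.le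

lemma right_mem : f.right ∈ Icc f.left f.right := right_mem_Icc.2 hf.left_lt_right.le

lemma left_le_map_left : f.left ≤ f.map f.left := (hf.mapsTo ⟨hf.left_mem, hf.left_lt.ne⟩).1

lemma map_right_le_right : f.map f.right ≤ f.right := (hf.mapsTo ⟨hf.right_mem, hf.lt_right.ne'⟩).2

lemma map_lt_right (hz : z ∈ Ico f.left f.crit) : f.map z < f.right := by
  obtain ⟨w, hzw, hwc⟩ := exists_between hz.2
  have hw : w ∈ Ico f.left f.crit := ⟨hz.1.trans hzw.le, hwc⟩
  have hwI : w ∈ Icc f.left f.right \ {f.crit} := ⟨⟨hw.1, (hwc.trans hf.lt_right).le⟩, hwc.ne⟩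
  exact (hf.strictMonoOn_left hz hw hzw).trans_le (hf.mapsTo hwI).2

lemma left_lt_map (hz : z ∈ Ioc f.crit f.right) : f.left < f.map z := by
  obtain ⟨w, hcw, hwz⟩ := exists_between hz.1
  have hw : w ∈ Ioc f.crit f.right := ⟨hcw, hwz.le.trans hz.2⟩
  have hwI : w ∈ Icc f.left f.right \ {f.crit} := ⟨⟨(hf.left_lt.trans hcw).le, hw.2⟩, hcw.ne'⟩
  exact (hf.mapsTo hwI).1.trans_lt (hf.strictMonoOn_right hw hz hwz)

lemma map_mem_Ioo (hz : z ∈ Ioo f.left f.right) (hzc : z ≠ f.crit) :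
    f.map z ∈ Ioo f.left f.right := by
  rcases lt_or_gt_of_ne hzc with h | h
  · have hzI : z ∈ Ico f.left f.crit := ⟨hz.1.le, h⟩
    exact ⟨hf.left_le_map_left.trans_lt
      (hf.strictMonoOn_left (left_mem_Ico.2 hf.left_lt) hzI hz.1), hf.map_lt_right hzI⟩
  · have hzI : z ∈ Ioc f.crit f.right := ⟨h, hz.2.le⟩
    exact ⟨hf.left_lt_map hzI, (hf.strictMonoOn_right hzI
      (right_mem_Ioc.2 hf.lt_right) hz.2).trans_le hf.map_right_le_right⟩

lemma iterate_mem_Icc (hz : z ∈ Icc f.left f.right) (hc : ∀ i < n, f.map^[i] z ≠ f.crit) :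
    f.map^[n] z ∈ Icc f.left f.right := by
  induction n with
  | zero => exact hz
  | succ n ih =>
    rw [Function.iterate_succ_apply']
    exact hf.mapsTo ⟨ih fun i hi => hc i (by omega), hc n n.lt_succ_self⟩

lemma iterate_mem_Ioo (hz : z ∈ Ioo f.left f.right) (hc : ∀ i < n, f.map^[i] z ≠ f.crit) :
    f.map^[n] z ∈ Ioo f.left f.right := by
  induction n with
  | zero => exact hz
  | succ n ih =>
    rw [Function.iterate_succ_apply']
    exact hf.map_mem_Ioo (ih fun i hi => hc i (by omega)) (hc n n.lt_succ_self)

lemma strictMonoOn_Icc (hz : f.left ≤ z) (hw : w ≤ f.right) (h : f.SameSide z w) :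
    StrictMonoOn f.map (Icc z w) := by
  rcases h with h | h
  · exact hf.strictMonoOn_left.mono fun u hu => ⟨hz.trans hu.1, hu.2.trans_lt h.2⟩
  · exact hf.strictMonoOn_right.mono fun u hu => ⟨h.1.trans_le hu.1, hu.2.trans hw⟩

lemma continuousOn_Icc (hz : f.left ≤ z) (hw : w ≤ f.right) (h : f.SameSide z w) :
    ContinuousOn f.map (Icc z w) := by
  rcases h with h | h
  · exact hf.continuousOn_left.mono fun u hu => ⟨hz.trans hu.1, hu.2.trans_lt h.2⟩
  · exact hf.continuousOn_right.mono fun u hu => ⟨h.1.trans_le hu.1, hu.2.trans hw⟩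

lemma mapsTo_iterate_Icc (hz : z ∈ Icc f.left f.right) (hw : w ∈ Icc f.left f.right)
    (h : f.SameItin n z w) :
    MapsTo f.map^[n] (Icc z w) (Icc (f.map^[n] z) (f.map^[n] w)) := by
  induction n with
  | zero => exact mapsTo_id _
  | succ n ih =>
    intro u hu
    have hn := h.mono n.le_succ
    have hside := h n n.lt_succ_self
    have hun := ih hn hu
    have hmono := (hf.strictMonoOn_Icc (hf.iterate_mem_Icc hz hn.ne_crit).1
      (hf.iterate_mem_Icc hw hn.symm.ne_crit).2 hside).monotoneOn
    have hle := hun.1.trans hun.2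
    simp only [Function.iterate_succ_apply']
    exact ⟨hmono (left_mem_Icc.2 hle) hun hun.1, hmono hun (right_mem_Icc.2 hle) hun.2⟩

lemma strictMonoOn_iterate (hz : z ∈ Icc f.left f.right) (hw : w ∈ Icc f.left f.right)
    (h : f.SameItin n z w) : StrictMonoOn f.map^[n] (Icc z w) := by
  induction n with
  | zero => exact strictMonoOn_id
  | succ n ih =>
    have hn := h.mono n.le_succ
    rw [Function.iterate_succ']
    exact (hf.strictMonoOn_Icc (hf.iterate_mem_Icc hz hn.ne_crit).1
      (hf.iterate_mem_Icc hw hn.symm.ne_crit).2 (h n n.lt_succ_self)).comp (ih hn)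
      (hf.mapsTo_iterate_Icc hz hw hn)

lemma continuousOn_iterate (hz : z ∈ Icc f.left f.right) (hw : w ∈ Icc f.left f.right)
    (h : f.SameItin n z w) : ContinuousOn f.map^[n] (Icc z w) := by
  induction n with
  | zero => exact continuousOn_id
  | succ n ih =>
    have hn := h.mono n.le_succ
    rw [Function.iterate_succ']
    exact (hf.continuousOn_Icc (hf.iterate_mem_Icc hz hn.ne_crit).1
      (hf.iterate_mem_Icc hw hn.symm.ne_crit).2 (h n n.lt_succ_self)).comp (ih hn)
      (hf.mapsTo_iterate_Icc hz hw hn)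

lemma sameItin_of_mem_Icc (hz : z ∈ Icc f.left f.right) (hw : w ∈ Icc f.left f.right)
    (h : f.SameItin n z w) (hu : u ∈ Icc z w) : f.SameItin n z u :=
  fun i hi => (h i hi).of_mem_Icc (hf.mapsTo_iterate_Icc hz hw (h.mono hi.le) hu)

lemma iterate_lt_iterate_iff (hz : z ∈ Icc f.left f.right) (hw : w ∈ Icc f.left f.right)
    (h : f.SameItin n z w) : f.map^[n] z < f.map^[n] w ↔ z < w := by
  rcases le_total z w with hzw | hwz
  · exact (hf.strictMonoOn_iterate hz hw h).lt_iff_lt (left_mem_Icc.2 hzw) (right_mem_Icc.2 hzw)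
  · exact (hf.strictMonoOn_iterate hw hz h.symm).lt_iff_lt (right_mem_Icc.2 hwz)
      (left_mem_Icc.2 hwz)

lemma iterate_le_iterate_iff (hz : z ∈ Icc f.left f.right) (hw : w ∈ Icc f.left f.right)
    (h : f.SameItin n z w) : f.map^[n] z ≤ f.map^[n] w ↔ z ≤ w :=
  le_iff_le_iff_lt_iff_lt.2 (hf.iterate_lt_iterate_iff hw hz h.symm)

lemma exists_iterate_eq (hz : z ∈ Icc f.left f.right) (hw : w ∈ Icc f.left f.right)
    (h : f.SameItin n z w) (hzw : z ≤ w) (ht : t ∈ Icc (f.map^[n] z) (f.map^[n] w)) :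
    ∃ u ∈ Icc z w, f.map^[n] u = t :=
  intermediate_value_Icc hzw (hf.continuousOn_iterate hz hw h) ht

lemma exists_left_preimage (ht : t ∈ Ico (f.map f.left) f.right) :
    ∃ u ∈ Ico f.left f.crit, f.map u = t := by
  obtain ⟨w, htw, hw⟩ := ((hf.tendsto_left.eventually (lt_mem_nhds ht.2)).and
    (Ico_mem_nhdsLT hf.left_lt)).exists
  have hsub : Icc f.left w ⊆ Ico f.left f.crit := Icc_subset_Ico_right hw.2
  obtain ⟨u, hu, rfl⟩ :=
    intermediate_value_Icc hw.1 (hf.continuousOn_left.mono hsub) ⟨ht.1, htw.le⟩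
  exact ⟨u, hsub hu, rfl⟩

lemma exists_right_preimage (ht : t ∈ Ioc f.left (f.map f.right)) :
    ∃ u ∈ Ioc f.crit f.right, f.map u = t := by
  obtain ⟨w, htw, hw⟩ := ((hf.tendsto_right.eventually (gt_mem_nhds ht.1)).and
    (Ioc_mem_nhdsGT hf.lt_right)).exists
  have hsub : Icc w f.right ⊆ Ioc f.crit f.right := Icc_subset_Ioc_left hw.1
  obtain ⟨u, hu, rfl⟩ :=
    intermediate_value_Icc hw.2 (hf.continuousOn_right.mono hsub) ⟨htw.le, ht.2⟩
  exact ⟨u, hsub hu, rfl⟩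

lemma continuousAt_map (hz : z ∈ Ioo f.left f.right) (hzc : z ≠ f.crit) :
    ContinuousAt f.map z := by
  rcases lt_or_gt_of_ne hzc with h | h
  · exact hf.continuousOn_left.continuousAt (Ico_mem_nhds hz.1 h)
  · exact hf.continuousOn_right.continuousAt (Ioc_mem_nhds h hz.2)

lemma continuousAt_iterate (hz : z ∈ Ioo f.left f.right)
    (hc : ∀ i < n, f.map^[i] z ≠ f.crit) : ContinuousAt f.map^[n] z := by
  induction n with
  | zero => exact continuousAt_id
  | succ n ih =>
    have hn : ∀ i < n, f.map^[i] z ≠ f.crit := fun i hi => hc i (by omega)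
    rw [Function.iterate_succ']
    exact (hf.continuousAt_map (hf.iterate_mem_Ioo hz hn) (hc n n.lt_succ_self)).comp (ih hn)

lemma eventually_sameItin (hz : z ∈ Ioo f.left f.right)
    (hc : ∀ i < n, f.map^[i] z ≠ f.crit) : ∀ᶠ w in 𝓝 z, f.SameItin n z w := by
  refine (eventually_all_finite (finite_Iio n)).2 fun i hi => ?_
  have hcont := hf.continuousAt_iterate hz fun j hj => hc j (hj.trans hi)
  rcases lt_or_gt_of_ne (hc i hi) with h | h
  · exact (hcont.eventually (gt_mem_nhds h)).mono fun w hw => Or.inl ⟨h, hw⟩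
  · exact (hcont.eventually (lt_mem_nhds h)).mono fun w hw => Or.inr ⟨h, hw⟩

end IsLorenz

/-! ### Reflection -/

/-- The conjugate of `f` by `x ↦ -x`, which exchanges the two branches. -/
def reflect (f : LorenzData) : LorenzData where
  left := -f.right
  right := -f.left
  crit := -f.crit
  map := fun x => -f.map (-x)

lemma reflect_map_iterate (n : ℕ) (z : ℝ) : f.reflect.map^[n] z = -f.map^[n] (-z) := by
  induction n with
  | zero => exact (neg_neg z).symm
  | succ n ih =>
    rw [Function.iterate_succ_apply', Function.iterate_succ_apply', ih]
    exact congrArg (fun x => -f.map x) (neg_neg _)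

lemma reflect_sameSide : f.reflect.SameSide z w ↔ f.SameSide (-z) (-w) := by
  simp only [SameSide, reflect, lt_neg, neg_lt]
  exact or_comm

lemma reflect_sameItin : f.reflect.SameItin n z w ↔ f.SameItin n (-z) (-w) := by
  simp only [SameItin, reflect_map_iterate, reflect_sameSide, neg_neg]

lemma IsLorenz.reflect (hf : f.IsLorenz) : f.reflect.IsLorenz where
  left_lt := neg_lt_neg hf.lt_right
  lt_right := neg_lt_neg hf.left_lt
  continuousOn_left := (hf.continuousOn_right.comp continuousOn_neg
    fun _ hx => ⟨lt_neg.2 hx.2, neg_le.2 hx.1⟩).neg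
  continuousOn_right := (hf.continuousOn_left.comp continuousOn_neg
    fun _ hx => ⟨le_neg.2 hx.2, neg_lt.2 hx.1⟩).neg
  strictMonoOn_left := fun _ hx _ hy h => neg_lt_neg (hf.strictMonoOn_right
    ⟨lt_neg.2 hy.2, neg_le.2 hy.1⟩ ⟨lt_neg.2 hx.2, neg_le.2 hx.1⟩ (neg_lt_neg h))
  strictMonoOn_right := fun _ hx _ hy h => neg_lt_neg (hf.strictMonoOn_left
    ⟨le_neg.2 hy.2, neg_lt.2 hy.1⟩ ⟨le_neg.2 hx.2, neg_lt.2 hx.1⟩ (neg_lt_neg h))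
  mapsTo := fun x hx => by
    have h := hf.mapsTo (x := -x)
      ⟨⟨le_neg.2 hx.1.2, neg_le.2 hx.1.1⟩, fun e => hx.2 (neg_eq_iff_eq_neg.1 e)⟩
    exact ⟨neg_le_neg h.2, neg_le_neg h.1⟩
  tendsto_left := (hf.tendsto_right.comp (tendsto_neg_nhdsLT_neg (a := f.crit))).neg
  tendsto_right := (hf.tendsto_left.comp (tendsto_neg_nhdsGT_neg (a := f.crit))).neg

/-! ### Topological expansion -/

/-- A Lorenz map is (topologically) expanding if distinct points have distinct itineraries, that
is, if no interval is mapped homeomorphically by all the iterates. -/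
structure IsExpanding (f : LorenzData) : Prop extends f.IsLorenz where
  exists_not_sameItin : ∀ z ∈ Icc f.left f.right, ∀ w ∈ Icc f.left f.right, z < w →
    ∃ n, ¬ f.SameItin n z w

namespace IsExpanding

variable (hf : f.IsExpanding)
include hf

lemma reflect : f.reflect.IsExpanding where
  toIsLorenz := hf.toIsLorenz.reflect
  exists_not_sameItin z hz w hw h := by
    obtain ⟨n, hn⟩ := hf.exists_not_sameItin (-w) ⟨le_neg.2 hw.2, neg_le.2 hw.1⟩ (-z)
      ⟨le_neg.2 hz.2, neg_le.2 hz.1⟩ (neg_lt_neg h)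
    exact ⟨n, fun h => hn (reflect_sameItin.1 h).symm⟩

lemma exists_crit_mem_Icc (hz : z ∈ Icc f.left f.right) (hw : w ∈ Icc f.left f.right)
    (hzw : z < w) : ∃ n, f.SameItin n z w ∧ f.crit ∈ Icc (f.map^[n] z) (f.map^[n] w) := by
  classical
  have hex := hf.exists_not_sameItin z hz w hw hzw
  obtain ⟨N, hN, hmin⟩ : ∃ N, ¬ f.SameItin N z w ∧ ∀ m < N, f.SameItin m z w :=
    ⟨Nat.find hex, Nat.find_spec hex, fun m hm => not_not.1 (Nat.find_min hex hm)⟩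
  rcases N with _ | n
  · exact absurd (SameItin.zero z w) hN
  · have h := hmin n n.lt_succ_self
    exact ⟨n, h, (not_sameSide_iff ((hf.iterate_le_iterate_iff hz hw h).2 hzw.le)).1
      fun hside => hN (h.succ hside)⟩

/-- Otherwise all the iterates of `f^n` would be homeomorphisms of `[z, w]` onto its image. -/
lemma not_sameItin_of_mapsTo_Icc (hz : z ∈ Icc f.left f.right) (hw : w ∈ Icc f.left f.right)
    (hzw : z < w) (hn : n ≠ 0) (hnz : z ≤ f.map^[n] z) (hnw : f.map^[n] w ≤ w) :
    ¬ f.SameItin n z w := by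
  intro h
  have hmaps : MapsTo f.map^[n] (Icc z w) (Icc z w) :=
    (hf.mapsTo_iterate_Icc hz hw h).mono_right (Icc_subset_Icc hnz hnw)
  have hall : ∀ k, f.SameItin (n * k) z w := by
    intro k
    induction k with
    | zero => exact SameItin.zero z w
    | succ k ih =>
      have hmem : ∀ {u}, u ∈ Icc z w → f.map^[n * k] u ∈ Icc z w := fun hu => by
        rw [Function.iterate_mul]
        exact hmaps.iterate k hu
      have hzk := hf.sameItin_of_mem_Icc hz hw h (hmem (left_mem_Icc.2 hzw.le))
      have hwk := hf.sameItin_of_mem_Icc hz hw h (hmem (right_mem_Icc.2 hzw.le))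
      rw [mul_add_one, add_comm]
      exact ih.add (hzk.symm.trans hwk)
  obtain ⟨k, hk⟩ := hf.exists_not_sameItin z hz w hw hzw
  exact hk ((hall k).mono (Nat.le_mul_of_pos_left k (Nat.pos_of_ne_zero hn)))

lemma map_lt_self (hz : z ∈ Ioo f.crit f.right) : f.map z < z := by
  by_contra! h
  exact hf.not_sameItin_of_mapsTo_Icc ⟨(hf.left_lt.trans hz.1).le, hz.2.le⟩ hf.right_mem hz.2
    one_ne_zero h hf.map_right_le_right (sameItin_one.2 (Or.inr ⟨hz.1, hf.lt_right⟩))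

lemma self_lt_map (hz : z ∈ Ioo f.left f.crit) : z < f.map z := by
  by_contra! h
  exact hf.not_sameItin_of_mapsTo_Icc hf.left_mem ⟨hz.1.le, (hz.2.trans hf.lt_right).le⟩ hz.1
    one_ne_zero hf.left_le_map_left h (sameItin_one.2 (Or.inl ⟨hf.left_lt, hz.2⟩))

end IsExpanding

end Itineraries

/-! ### Piecewise linear Lorenz maps -/

section PwLinear

variable {f : LorenzData} {a b : ℝ} {n : ℕ} {s x w z : ℝ}

/-- `f` is the Lorenz map with slope `a` to the left and slope `b` to the right of the critical
point. The condition `overlap` on the images of the end points says that `f` expands on average: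
the slopes, weighted with the lengths of the branches, have mean greater than one. -/
structure IsPwLinear (f : LorenzData) (a b : ℝ) : Prop extends f.IsLorenz where
  map_of_lt : ∀ x ∈ Ico f.left f.crit, f.map x = f.right - a * (f.crit - x)
  map_of_gt : ∀ x ∈ Ioc f.crit f.right, f.map x = f.left + b * (x - f.crit)
  overlap : f.map f.left < f.map f.right

/-- The slope at `x` of a map with slope `a` to the left and slope `b` to the right of the critical
point. -/
noncomputable def slope (f : LorenzData) (a b x : ℝ) : ℝ :=
  if x < f.crit then a else b

/-- The slope of the `n`-th iterate at `x`. -/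
noncomputable def iterSlope (f : LorenzData) (a b : ℝ) (n : ℕ) (x : ℝ) : ℝ :=
  ∏ i ∈ Finset.range n, f.slope a b (f.map^[i] x)

lemma iterSlope_zero (a b x : ℝ) : f.iterSlope a b 0 x = 1 := rfl

lemma iterSlope_succ (a b : ℝ) (n : ℕ) (x : ℝ) :
    f.iterSlope a b (n + 1) x = f.iterSlope a b n x * f.slope a b (f.map^[n] x) :=
  Finset.prod_range_succ _ _

lemma iterSlope_add (a b : ℝ) (m n : ℕ) (x : ℝ) :
    f.iterSlope a b (m + n) x = f.iterSlope a b m (f.map^[n] x) * f.iterSlope a b n x := by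
  rw [add_comm, mul_comm, iterSlope, Finset.prod_range_add]
  simp only [iterSlope, ← Function.iterate_add_apply, add_comm n]

lemma iterSlope_mul_of_iterate_eq (a b : ℝ) (h : f.map^[n] x = x) (k : ℕ) :
    f.iterSlope a b (n * k) x = f.iterSlope a b n x ^ k := by
  induction k with
  | zero => rfl
  | succ k ih =>
    rw [mul_add_one, add_comm, iterSlope_add, Function.iterate_mul, Function.iterate_fixed h, ih,
      pow_succ']

lemma pow_le_iterSlope (hs : 0 ≤ s) (ha : s ≤ a) (hb : s ≤ b) (n : ℕ) (x : ℝ) :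
    s ^ n ≤ f.iterSlope a b n x := by
  calc s ^ n = ∏ _i ∈ Finset.range n, s := by rw [Finset.prod_const, Finset.card_range]
    _ ≤ f.iterSlope a b n x := Finset.prod_le_prod (fun _ _ => hs) fun i _ => by
      unfold slope
      split_ifs
      exacts [ha, hb]

lemma reflect_slope (hz : z ≠ f.crit) : f.reflect.slope b a (-z) = f.slope a b z := by
  simp only [slope, reflect, neg_lt_neg_iff]
  grind

lemma reflect_iterSlope (h : ∀ i < n, f.map^[i] z ≠ f.crit) :
    f.reflect.iterSlope b a n (-z) = f.iterSlope a b n z := by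
  refine Finset.prod_congr rfl fun i hi => ?_
  rw [reflect_map_iterate, neg_neg, reflect_slope (h i (Finset.mem_range.1 hi))]

namespace IsPwLinear

variable (hf : f.IsPwLinear a b)
include hf

lemma reflect : f.reflect.IsPwLinear b a where
  toIsLorenz := hf.toIsLorenz.reflect
  map_of_lt x hx := by
    simp only [LorenzData.reflect, hf.map_of_gt (-x) ⟨lt_neg.2 hx.2, neg_le.2 hx.1⟩]
    ring
  map_of_gt x hx := by
    simp only [LorenzData.reflect, hf.map_of_lt (-x) ⟨le_neg.2 hx.2, neg_lt.2 hx.1⟩]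
    ring
  overlap := by
    simp only [LorenzData.reflect, neg_neg]
    exact neg_lt_neg hf.overlap

lemma map_left : f.map f.left = f.right - a * (f.crit - f.left) :=
  hf.map_of_lt _ (left_mem_Ico.2 hf.left_lt)

lemma map_right : f.map f.right = f.left + b * (f.right - f.crit) :=
  hf.map_of_gt _ (right_mem_Ioc.2 hf.lt_right)

lemma a_pos : 0 < a := by
  have h := hf.map_lt_right (left_mem_Ico.2 hf.left_lt)
  rw [hf.map_left, sub_lt_self_iff] at h
  exact pos_of_mul_pos_left h (sub_pos.2 hf.left_lt).le

lemma b_pos : 0 < b := hf.reflect.a_pos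

lemma slope_pos (x : ℝ) : 0 < f.slope a b x := by
  unfold slope
  split_ifs
  exacts [hf.a_pos, hf.b_pos]

lemma iterSlope_pos (n : ℕ) (x : ℝ) : 0 < f.iterSlope a b n x :=
  Finset.prod_pos fun _ _ => hf.slope_pos _

lemma map_sub_map (hz : z ∈ Icc f.left f.right) (hw : w ∈ Icc f.left f.right)
    (h : f.SameSide z w) : f.map w - f.map z = f.slope a b z * (w - z) := by
  rcases h with h | h
  · rw [hf.map_of_lt z ⟨hz.1, h.1⟩, hf.map_of_lt w ⟨hw.1, h.2⟩, slope, if_pos h.1]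
    ring
  · rw [hf.map_of_gt z ⟨h.1, hz.2⟩, hf.map_of_gt w ⟨h.2, hw.2⟩, slope, if_neg h.1.not_gt]
    ring

lemma iterate_sub_iterate (hz : z ∈ Icc f.left f.right) (hw : w ∈ Icc f.left f.right)
    (h : f.SameItin n z w) : f.map^[n] w - f.map^[n] z = f.iterSlope a b n z * (w - z) := by
  induction n with
  | zero => simp only [Function.iterate_zero, id, iterSlope_zero, one_mul]
  | succ n ih =>
    have hn := h.mono n.le_succ
    rw [Function.iterate_succ_apply', Function.iterate_succ_apply',
      hf.map_sub_map (hf.iterate_mem_Icc hz hn.ne_crit) (hf.iterate_mem_Icc hw hn.symm.ne_crit)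
        (h n n.lt_succ_self), ih hn, iterSlope_succ]
    ring

/-- The affine weight `ψ x = 1 + m (x - crit)` makes `slope x * ψ x - ψ (f x)` constant on each
branch, with the values `a - 1 - m (right - crit)` and `b - 1 + m (crit - left)`. By `overlap`
there is an `m` for which both are positive and `ψ` is positive on the whole interval. -/
lemma exists_weight : ∃ (ψ : ℝ → ℝ) (δ κ K : ℝ), 0 < δ ∧ 0 < κ ∧
    (∀ x ∈ Icc f.left f.right, ψ x ∈ Icc κ K) ∧
    ∀ x ∈ Icc f.left f.right, x ≠ f.crit → ψ (f.map x) + δ ≤ f.slope a b x * ψ x := by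
  have hp : 0 < f.crit - f.left := sub_pos.2 hf.left_lt
  have hq : 0 < f.right - f.crit := sub_pos.2 hf.lt_right
  have ha := hf.a_pos
  have hb := hf.b_pos
  have hover := hf.overlap
  rw [hf.map_left, hf.map_right] at hover
  obtain ⟨m, hm₁, hm₂⟩ : ∃ m, max (-1 / (f.right - f.crit)) ((1 - b) / (f.crit - f.left)) < m ∧
      m < min ((a - 1) / (f.right - f.crit)) (1 / (f.crit - f.left)) := by
    refine exists_between (max_lt (lt_min ?_ ?_) (lt_min ?_ ?_)) <;>
      rw [div_lt_div_iff₀ (by assumption) (by assumption)] <;> nlinarith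
  obtain ⟨hψright, hδb⟩ := max_lt_iff.1 hm₁
  obtain ⟨hδa, hψleft⟩ := lt_min_iff.1 hm₂
  rw [div_lt_iff₀ (by assumption)] at hψright hδb
  rw [lt_div_iff₀ (by assumption)] at hδa hψleft
  refine ⟨fun x => 1 + m * (x - f.crit),
    min (a - 1 - m * (f.right - f.crit)) (b - 1 + m * (f.crit - f.left)),
    min (1 + m * (f.left - f.crit)) (1 + m * (f.right - f.crit)),
    max (1 + m * (f.left - f.crit)) (1 + m * (f.right - f.crit)),
    lt_min (by linarith) (by linarith), lt_min (by linarith) (by linarith),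
    fun x hx => ?_, fun x hx hxc => ?_⟩
  · rw [mem_Icc, min_le_iff, le_max_iff]
    rcases le_total 0 m with hm | hm
    · exact ⟨Or.inl (by nlinarith [hx.1]), Or.inr (by nlinarith [hx.2])⟩
    · exact ⟨Or.inr (by nlinarith [hx.2]), Or.inl (by nlinarith [hx.1])⟩
  · rcases lt_or_gt_of_ne hxc with h | h
    · rw [hf.map_of_lt x ⟨hx.1, h⟩, slope, if_pos h]
      linarith [min_le_left (a - 1 - m * (f.right - f.crit)) (b - 1 + m * (f.crit - f.left))]
    · rw [hf.map_of_gt x ⟨h, hx.2⟩, slope, if_neg h.not_gt]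
      linarith [min_le_right (a - 1 - m * (f.right - f.crit)) (b - 1 + m * (f.crit - f.left))]

lemma pow_mul_le_iterSlope_mul {ψ : ℝ → ℝ} {lam : ℝ} (hlam : 0 ≤ lam)
    (hψ : ∀ x ∈ Icc f.left f.right, x ≠ f.crit → lam * ψ (f.map x) ≤ f.slope a b x * ψ x)
    (hx : x ∈ Icc f.left f.right) (hc : ∀ i < n, f.map^[i] x ≠ f.crit) :
    lam ^ n * ψ (f.map^[n] x) ≤ f.iterSlope a b n x * ψ x := by
  induction n with
  | zero => exact le_rfl
  | succ n ih =>
    have hn : ∀ i < n, f.map^[i] x ≠ f.crit := fun i hi => hc i (by omega)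
    have hstep := hψ _ (hf.iterate_mem_Icc hx hn) (hc n n.lt_succ_self)
    rw [← Function.iterate_succ_apply' f.map] at hstep
    calc lam ^ (n + 1) * ψ (f.map^[n + 1] x)
        = lam ^ n * (lam * ψ (f.map^[n + 1] x)) := by ring
      _ ≤ lam ^ n * (f.slope a b (f.map^[n] x) * ψ (f.map^[n] x)) := by gcongr
      _ = f.slope a b (f.map^[n] x) * (lam ^ n * ψ (f.map^[n] x)) := by ring
      _ ≤ f.slope a b (f.map^[n] x) * (f.iterSlope a b n x * ψ x) :=
        mul_le_mul_of_nonneg_left (ih hn) (hf.slope_pos _).le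
      _ = f.iterSlope a b (n + 1) x * ψ x := by rw [iterSlope_succ]; ring

theorem exists_mul_pow_le_iterSlope : ∃ κ lam : ℝ, 0 < κ ∧ 1 < lam ∧
    ∀ n, ∀ x ∈ Icc f.left f.right, (∀ i < n, f.map^[i] x ≠ f.crit) →
      κ * lam ^ n ≤ f.iterSlope a b n x := by
  obtain ⟨ψ, δ, κ, K, hδ, hκ, hψ, hstep⟩ := hf.exists_weight
  have hK : 0 < K := hκ.trans_le ((hψ _ hf.left_mem).1.trans (hψ _ hf.left_mem).2)
  have hlam : 0 < 1 + δ / K := by positivity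
  have hexp : ∀ x ∈ Icc f.left f.right, x ≠ f.crit →
      (1 + δ / K) * ψ (f.map x) ≤ f.slope a b x * ψ x := fun x hx hxc =>
    calc (1 + δ / K) * ψ (f.map x) = ψ (f.map x) + δ * (ψ (f.map x) / K) := by ring
      _ ≤ ψ (f.map x) + δ * 1 := by
        gcongr
        exact (div_le_one hK).2 (hψ _ (hf.mapsTo ⟨hx, hxc⟩)).2
      _ ≤ f.slope a b x * ψ x := by linarith [hstep x hx hxc]
  refine ⟨κ / K, 1 + δ / K, div_pos hκ hK, lt_add_of_pos_right 1 (div_pos hδ hK),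
    fun n x hx hc => ?_⟩
  rw [div_mul_eq_mul_div, div_le_iff₀ hK]
  calc κ * (1 + δ / K) ^ n ≤ ψ (f.map^[n] x) * (1 + δ / K) ^ n := by
        gcongr
        exact (hψ _ (hf.iterate_mem_Icc hx hc)).1
    _ ≤ f.iterSlope a b n x * ψ x := by
        rw [mul_comm]
        exact hf.pow_mul_le_iterSlope_mul hlam.le hexp hx hc
    _ ≤ f.iterSlope a b n x * K :=
        mul_le_mul_of_nonneg_left (hψ x hx).2 (hf.iterSlope_pos n x).le

theorem isExpanding : f.IsExpanding where
  toIsLorenz := hf.toIsLorenz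
  exists_not_sameItin z hz w hw hzw := by
    by_contra! h
    obtain ⟨κ, lam, hκ, hlam, hexp⟩ := hf.exists_mul_pow_le_iterSlope
    have hpos : 0 < κ * (w - z) := mul_pos hκ (sub_pos.2 hzw)
    obtain ⟨n, hn⟩ := pow_unbounded_of_one_lt ((f.right - f.left) / (κ * (w - z))) hlam
    rw [div_lt_iff₀ hpos] at hn
    have hz' := hf.iterate_mem_Icc hz (h n).ne_crit
    have hw' := hf.iterate_mem_Icc hw (h n).symm.ne_crit
    have hsub := hf.iterate_sub_iterate hz hw (h n)
    have hle := mul_le_mul_of_nonneg_right (hexp n z hz (h n).ne_crit) (sub_pos.2 hzw).le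
    linarith [hz'.1, hw'.2]

lemma one_lt_iterSlope (hx : x ∈ Icc f.left f.right) (hc : ∀ i, f.map^[i] x ≠ f.crit)
    (hn : n ≠ 0) (h : f.map^[n] x = x) : 1 < f.iterSlope a b n x := by
  by_contra! hle
  obtain ⟨κ, lam, hκ, hlam, hexp⟩ := hf.exists_mul_pow_le_iterSlope
  obtain ⟨k, hk⟩ := pow_unbounded_of_one_lt κ⁻¹ hlam
  have hpow : lam ^ k ≤ lam ^ (n * k) :=
    pow_le_pow_right₀ hlam.le (Nat.le_mul_of_pos_left k (Nat.pos_of_ne_zero hn))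
  have hbound := hexp (n * k) x hx fun i _ => hc i
  rw [iterSlope_mul_of_iterate_eq a b h] at hbound
  have hle_one := pow_le_one₀ (n := k) (hf.iterSlope_pos n x).le hle
  have hgt : 1 < κ * lam ^ (n * k) := by
    rw [← inv_lt_iff_one_lt_mul₀' hκ]
    exact hk.trans_le hpow
  linarith

end IsPwLinear

end PwLinear

/-! ### Periodic points -/

section PeriodicPoints

variable {f : LorenzData} {a b : ℝ} {n : ℕ} {δ w z : ℝ}

/-- A backward orbit in `K` accumulates somewhere, and any two of its terms are linked by the
map. -/
lemma exists_dist_iterate_lt_of_isCompact {X : Type*} [PseudoMetricSpace X] {F : X → X} {K : Set X}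
    (hK : IsCompact K) (hne : K.Nonempty) (hsub : K ⊆ F '' K) {ε : ℝ} (hε : 0 < ε) (M : ℕ) :
    ∃ n ≥ M, ∃ z, (∀ i ≤ n, F^[i] z ∈ K) ∧ dist z (F^[n] z) < ε := by
  obtain ⟨x, hx⟩ := hne
  choose! G hGK hFG using hsub
  have hGmem : ∀ k, G^[k] x ∈ K := fun k => MapsTo.iterate hGK k hx
  have hFiter : ∀ i k, F^[i] (G^[i + k] x) = G^[k] x := by
    intro i k
    induction i with
    | zero => rw [Nat.zero_add, Function.iterate_zero, id]
    | succ i ih =>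
      rw [Function.iterate_succ_apply, add_right_comm, Function.iterate_succ_apply' G,
        hFG (hGmem _), ih]
  obtain ⟨y, -, φ, hφ, hlim⟩ := hK.tendsto_subseq hGmem
  obtain ⟨N, hN⟩ := Metric.cauchySeq_iff'.1 hlim.cauchySeq ε hε
  obtain ⟨n, hn⟩ := Nat.exists_eq_add_of_le' (le_of_add_le_right (hφ.add_le_nat M N))
  refine ⟨n, ?_, G^[φ (M + N)] x, fun i hi => ?_, ?_⟩
  · have := hφ.add_le_nat M N
    omega
  · rw [hn, ← Nat.add_sub_cancel' hi, add_assoc, hFiter]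
    exact hGmem _
  · have hdist := hN (M + N) (Nat.le_add_left N M)
    rwa [hn, hFiter, ← hn]

namespace IsLorenz

variable (hf : f.IsLorenz)
include hf

lemma tendsto_map_map_left : Tendsto (fun s => f.map (f.map s)) (𝓝[<] f.crit)
    (𝓝 (f.map f.right)) := by
  refine (hf.continuousOn_right _ (right_mem_Ioc.2 hf.lt_right)).tendsto.comp
    (tendsto_nhdsWithin_iff.2 ⟨hf.tendsto_left, ?_⟩)
  filter_upwards [hf.tendsto_left.eventually (lt_mem_nhds hf.lt_right),
    Ico_mem_nhdsLT hf.left_lt] with s hs hsI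
  exact ⟨hs, (hf.map_lt_right hsI).le⟩

lemma tendsto_map_map_right : Tendsto (fun s => f.map (f.map s)) (𝓝[>] f.crit)
    (𝓝 (f.map f.left)) := by
  refine (hf.continuousOn_left _ (left_mem_Ico.2 hf.left_lt)).tendsto.comp
    (tendsto_nhdsWithin_iff.2 ⟨hf.tendsto_right, ?_⟩)
  filter_upwards [hf.tendsto_right.eventually (gt_mem_nhds hf.left_lt),
    Ioc_mem_nhdsGT hf.lt_right] with s hs hsI
  exact ⟨(hf.left_lt_map hsI).le, hs⟩

/-- With `s` and `s'` close to the critical point on its two sides, `K` is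
`[f s', s] ∪ [s', f s]`: the images of the two intervals cover `[f s', f s]`. -/
lemma exists_isCompact_subset_image (hover : f.map f.left < f.map f.right) :
    ∃ K, IsCompact K ∧ K.Nonempty ∧ K ⊆ Ioo f.left f.right \ {f.crit} ∧ K ⊆ f.map '' K := by
  obtain ⟨d, hd, hd'⟩ := exists_between hover
  obtain ⟨p, hp, hpc⟩ := exists_between hf.left_lt
  obtain ⟨q, hcq, hq⟩ := exists_between hf.lt_right
  obtain ⟨s, hs, hqs, hds⟩ := ((eventually_mem_set.2 (Ioo_mem_nhdsLT hpc)).and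
    ((hf.tendsto_left.eventually (lt_mem_nhds hq)).and
      (hf.tendsto_map_map_left.eventually (lt_mem_nhds hd')))).exists
  obtain ⟨s', hs', hps', hds'⟩ := ((eventually_mem_set.2 (Ioo_mem_nhdsGT hcq)).and
    ((hf.tendsto_right.eventually (gt_mem_nhds hp)).and
      (hf.tendsto_map_map_right.eventually (gt_mem_nhds hd)))).exists
  have hls' : f.left < f.map s' := hf.left_lt_map ⟨hs'.1, (hs'.2.trans hq).le⟩
  have hsr : f.map s < f.right := hf.map_lt_right ⟨(hp.trans hs.1).le, hs.2⟩
  have hle : f.map s' ≤ s := (hps'.trans hs.1).le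
  have hle' : s' ≤ f.map s := (hs'.2.trans hqs).le
  refine ⟨Icc (f.map s') s ∪ Icc s' (f.map s), isCompact_Icc.union isCompact_Icc,
    ⟨s, Or.inl (right_mem_Icc.2 hle)⟩, ?_, fun t ht => ?_⟩
  · rintro t (ht | ht)
    · exact ⟨⟨hls'.trans_le ht.1, by linarith [ht.2, hs.2]⟩, (ht.2.trans_lt hs.2).ne⟩
    · exact ⟨⟨by linarith [ht.1, hs'.1], ht.2.trans_lt hsr⟩, (hs'.1.trans_le ht.1).ne'⟩
  · have htI : t ∈ Icc (f.map s') (f.map s) := by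
      rcases ht with ht | ht
      · exact ⟨ht.1, by linarith [ht.2, hs.2]⟩
      · exact ⟨by linarith [ht.1, hs'.1], ht.2⟩
    rcases le_total d t with hdt | htd
    · obtain ⟨u, hu, rfl⟩ := hf.exists_iterate_eq (n := 1) ⟨hls'.le, by linarith [hs.2]⟩
        ⟨by linarith [hs.1], by linarith [hs.2]⟩
        (sameItin_one.2 (Or.inl ⟨hle.trans_lt hs.2, hs.2⟩)) hle ⟨hds'.le.trans hdt, htI.2⟩
      exact ⟨u, Or.inl hu, rfl⟩
    · obtain ⟨u, hu, rfl⟩ := hf.exists_iterate_eq (n := 1)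
        ⟨by linarith [hs'.1], by linarith [hs'.2]⟩ ⟨by linarith [hs'.1], hsr.le⟩
        (sameItin_one.2 (Or.inr ⟨hs'.1, hs'.1.trans_le hle'⟩)) hle' ⟨htI.1, htd.trans hds.le⟩
      exact ⟨u, Or.inr hu, rfl⟩

end IsLorenz

lemma isPeriodicPoint_of_iterate_eq (hz : z ∈ Icc f.left f.right) (hn : n ≠ 0)
    (hc : ∀ i < n, f.map^[i] z ≠ f.crit) (h : f.map^[n] z = z) : f.IsPeriodicPoint z := by
  have hper : Function.IsPeriodicPt f.map n z := h
  refine ⟨hz, fun i => ?_, Function.mk_mem_periodicPts (Nat.pos_of_ne_zero hn) hper⟩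
  rw [← hper.iterate_mod_apply]
  exact hc _ (Nat.mod_lt i (Nat.pos_of_ne_zero hn))

namespace IsPwLinear

variable (hf : f.IsPwLinear a b)
include hf

lemma sameItin_of_iterSlope_mul_lt {κ : ℝ} (hκ₀ : 0 < κ)
    (hκ : ∀ m, ∀ x ∈ Icc f.left f.right, (∀ i < m, f.map^[i] x ≠ f.crit) →
      κ ≤ f.iterSlope a b m x)
    (hz : z ∈ Icc f.left f.right) (hw : w ∈ Icc f.left f.right)
    (hδ : ∀ i < n, ∀ t, |t - f.map^[i] z| < δ → f.SameSide (f.map^[i] z) t)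
    (h : f.iterSlope a b n z * |w - z| < κ * δ) : f.SameItin n z w := by
  have hδ₀ : 0 < δ := pos_of_mul_pos_right
    ((mul_nonneg (hf.iterSlope_pos n z).le (abs_nonneg _)).trans_lt h) hκ₀.le
  have hc : ∀ i < n, f.map^[i] z ≠ f.crit := fun i hi =>
    (hδ i hi _ (by rwa [sub_self, abs_zero])).ne_crit
  suffices ∀ m ≤ n, f.SameItin m z w from this n le_rfl
  intro m
  induction m with
  | zero => exact fun _ => SameItin.zero z w
  | succ m ih =>
    intro hm
    have hsame := ih (by omega)
    refine hsame.succ (hδ m hm _ ?_)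
    rw [hf.iterate_sub_iterate hz hw hsame, abs_mul, abs_of_pos (hf.iterSlope_pos m z)]
    have hrest : κ ≤ f.iterSlope a b (n - m) (f.map^[m] z) := by
      refine hκ _ _ (hf.iterate_mem_Icc hz hsame.ne_crit) fun i hi => ?_
      rw [← Function.iterate_add_apply]
      exact hc _ (by omega)
    have hsplit := iterSlope_add (f := f) a b (n - m) m z
    rw [Nat.sub_add_cancel (by omega)] at hsplit
    refine lt_of_mul_lt_mul_left (lt_of_le_of_lt ?_ h) hκ₀.le
    rw [hsplit, ← mul_assoc]
    have := (hf.iterSlope_pos m z).le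
    gcongr

lemma isPeriodicPoint_add_div (hn : n ≠ 0) (hz : z ∈ Icc f.left f.right)
    (hS : 1 < f.iterSlope a b n z)
    (hw : z + (z - f.map^[n] z) / (f.iterSlope a b n z - 1) ∈ Icc f.left f.right)
    (h : f.SameItin n z (z + (z - f.map^[n] z) / (f.iterSlope a b n z - 1))) :
    f.IsPeriodicPoint (z + (z - f.map^[n] z) / (f.iterSlope a b n z - 1)) := by
  refine isPeriodicPoint_of_iterate_eq hw hn h.symm.ne_crit ?_
  have hsub := hf.iterate_sub_iterate hz hw h
  have hne := (sub_pos.2 hS).ne'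
  rw [sub_eq_iff_eq_add.1 hsub]
  field_simp
  ring

/-- A point that nearly returns is close to the fixed point of the affine branch of its return
map, since the slope of the latter is large. -/
theorem exists_isPeriodicPoint : ∃ x, f.IsPeriodicPoint x := by
  obtain ⟨K, hK, hne, hsub, hKK⟩ := hf.exists_isCompact_subset_image hf.overlap
  obtain ⟨δ, hδ, hδK⟩ := hK.exists_thickening_subset_open
    (isOpen_Ioo.sdiff isClosed_singleton) hsub
  have hnear : ∀ x ∈ K, ∀ t, |t - x| < δ → t ∈ Ioo f.left f.right \ {f.crit} := fun x hx t ht =>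
    hδK (Metric.mem_thickening_iff.2 ⟨x, hx, ht⟩)
  have hside : ∀ x ∈ K, ∀ t, |t - x| < δ → f.SameSide x t := by
    intro x hx t ht
    have hxc := hnear x hx f.crit
    have htc := (hnear x hx t ht).2
    unfold SameSide
    grind
  obtain ⟨κ, lam, hκ, hlam, hexp⟩ := hf.exists_mul_pow_le_iterSlope
  obtain ⟨M, hM⟩ := pow_unbounded_of_one_lt (2 / κ) hlam
  rw [div_lt_iff₀' hκ] at hM
  obtain ⟨n, hn, z, hz, hdist⟩ := exists_dist_iterate_lt_of_isCompact hK hne hKK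
    (show 0 < κ * δ / 2 by positivity) M
  have hzI : ∀ i ≤ n, f.map^[i] z ∈ Icc f.left f.right := fun i hi =>
    Ioo_subset_Icc_self (hsub (hz i hi)).1
  have hc : ∀ i < n, f.map^[i] z ≠ f.crit := fun i hi => (hsub (hz i hi.le)).2
  have hS : 2 < f.iterSlope a b n z :=
    calc 2 < κ * lam ^ M := hM
      _ ≤ κ * lam ^ n := by gcongr; exact hlam.le
      _ ≤ f.iterSlope a b n z := hexp n z (hzI 0 n.zero_le) hc
  have hwz : f.iterSlope a b n z *
      |z + (z - f.map^[n] z) / (f.iterSlope a b n z - 1) - z| < κ * δ := by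
    rw [Real.dist_eq] at hdist
    rw [add_sub_cancel_left, abs_div, abs_of_pos (sub_pos.2 (one_lt_two.trans hS)),
      ← mul_div_assoc, div_lt_iff₀ (sub_pos.2 (one_lt_two.trans hS))]
    nlinarith [abs_nonneg (z - f.map^[n] z)]
  have hκ_le : ∀ m, ∀ x ∈ Icc f.left f.right, (∀ i < m, f.map^[i] x ≠ f.crit) →
      κ ≤ f.iterSlope a b m x := fun m x hx hxc =>
    (le_mul_of_one_le_right hκ.le (one_le_pow₀ hlam.le)).trans (hexp m x hx hxc)
  have hκS : κ ≤ f.iterSlope a b n z := hκ_le n z (hzI 0 n.zero_le) hc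
  have hwI := Ioo_subset_Icc_self (hnear z (hz 0 n.zero_le) _ (lt_of_mul_lt_mul_left
    ((mul_le_mul_of_nonneg_right hκS (abs_nonneg _)).trans_lt hwz) hκ.le)).1
  have hn₀ : n ≠ 0 := by
    rintro rfl
    rw [iterSlope_zero] at hS
    linarith
  exact ⟨_, hf.isPeriodicPoint_add_div hn₀ (hzI 0 n.zero_le) (one_lt_two.trans hS) hwI
    (hf.sameItin_of_iterSlope_mul_lt hκ hκ_le (hzI 0 n.zero_le) hwI
      (fun i hi => hside _ (hz i hi.le)) hwz)⟩

end IsPwLinear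

end PeriodicPoints

/-! ### Completely invariant sets -/

section CompletelyInvariantSets

open scoped Pointwise

variable {f : LorenzData} {a b : ℝ} {E : Set ℝ} {n : ℕ} {e₀ e₁ w x y z : ℝ}

lemma IsLorenz.mem_of_iterate_mem (hf : f.IsLorenz)
    (hpre : ∀ z ∈ Ioo f.left f.right \ {f.crit}, f.map z ∈ E → z ∈ E)
    (hz : z ∈ Ioo f.left f.right) (hc : ∀ i < n, f.map^[i] z ≠ f.crit) (h : f.map^[n] z ∈ E) :
    z ∈ E := by
  induction n with
  | zero => exact h
  | succ n ih =>
    rw [Function.iterate_succ_apply'] at h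
    have hn : ∀ i < n, f.map^[i] z ≠ f.crit := fun i hi => hc i (by omega)
    exact ih hn (hpre _ ⟨hf.iterate_mem_Ioo hz hn, hc n n.lt_succ_self⟩ h)

namespace IsProperCompletelyInvariant

variable (hE : f.IsProperCompletelyInvariant E)
include hE

lemma mem_Ioo (hz : z ∈ E) : z ∈ Ioo f.left f.right := (hE.subset hz).1

lemma mem_Icc (hz : z ∈ E) : z ∈ Icc f.left f.right := Ioo_subset_Icc_self (hE.mem_Ioo hz)

lemma ne_crit (hz : z ∈ E) : z ≠ f.crit := (hE.subset hz).2

lemma map_mem (hz : z ∈ E) : f.map z ∈ E := hE.image_eq.subset (mem_image_of_mem _ hz)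

lemma exists_preimage (hz : z ∈ E) : ∃ w ∈ E, f.map w = z := hE.image_eq.superset hz

lemma iterate_mem (hz : z ∈ E) (n : ℕ) : f.map^[n] z ∈ E :=
  MapsTo.iterate (fun _ => hE.map_mem) n hz

lemma iterate_ne_crit (hz : z ∈ E) (n : ℕ) : f.map^[n] z ≠ f.crit :=
  hE.ne_crit (hE.iterate_mem hz n)

lemma mem_of_map_mem (hz : z ∈ Ioo f.left f.right \ {f.crit}) (h : f.map z ∈ E) : z ∈ E :=
  hE.preimage_eq.subset ⟨hz, h⟩

lemma isCompact : IsCompact E :=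
  isCompact_Icc.of_isClosed_subset hE.isClosed fun _ => hE.mem_Icc

lemma disjoint_Ioo_iterate (hf : f.IsLorenz) (hz : z ∈ Icc f.left f.right)
    (hw : w ∈ Icc f.left f.right) (h : f.SameItin n z w) (hdisj : Disjoint E (Ioo z w)) :
    Disjoint E (Ioo (f.map^[n] z) (f.map^[n] w)) := by
  refine disjoint_left.2 fun t htE ht => ?_
  have hzw := (hf.iterate_lt_iterate_iff hz hw h).1 (ht.1.trans ht.2)
  obtain ⟨u, hu, rfl⟩ := hf.exists_iterate_eq hz hw h hzw.le (Ioo_subset_Icc_self ht)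
  have huzw : u ∈ Ioo z w := ⟨hu.1.lt_of_ne (by rintro rfl; exact ht.1.false),
    hu.2.lt_of_ne (by rintro rfl; exact ht.2.false)⟩
  have hzu := hf.sameItin_of_mem_Icc hz hw h hu
  exact disjoint_left.1 hdisj (hf.mem_of_iterate_mem (fun _ => hE.mem_of_map_mem)
    ⟨hz.1.trans_lt huzw.1, huzw.2.trans_le hw.2⟩ hzu.symm.ne_crit htE) huzw

lemma reflect : f.reflect.IsProperCompletelyInvariant (-E) where
  nonempty := hE.nonempty.neg
  isClosed := hE.isClosed.neg
  subset z hz :=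
    ⟨⟨neg_lt.1 (hE.mem_Ioo hz).2, lt_neg.1 (hE.mem_Ioo hz).1⟩,
      fun h => hE.ne_crit hz (neg_eq_iff_eq_neg.2 h)⟩
  image_eq := by
    refine subset_antisymm ?_ fun z hz => ?_
    · rintro _ ⟨z, hz, rfl⟩
      exact neg_mem_neg.2 (hE.map_mem hz)
    · obtain ⟨w, hw, h⟩ := hE.exists_preimage hz
      exact ⟨-w, neg_mem_neg.2 hw, by simp only [LorenzData.reflect, neg_neg, h]⟩
  preimage_eq := by
    refine subset_antisymm ?_ fun z hz => ⟨⟨?_, ?_⟩, ?_⟩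
    · rintro z ⟨⟨hz, hzc⟩, h⟩
      exact hE.mem_of_map_mem ⟨⟨lt_neg.2 hz.2, neg_lt.2 hz.1⟩,
        fun e => hzc (neg_eq_iff_eq_neg.1 e)⟩ (neg_mem_neg.1 h)
    · exact ⟨neg_lt.1 (hE.mem_Ioo hz).2, lt_neg.1 (hE.mem_Ioo hz).1⟩
    · exact fun h => hE.ne_crit hz (neg_eq_iff_eq_neg.2 h)
    · exact neg_mem_neg.2 (hE.map_mem hz)

end IsProperCompletelyInvariant

lemma IsLorenz.isProperCompletelyInvariant (hf : f.IsLorenz) (hover : f.map f.left < f.map f.right)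
    (hne : E.Nonempty) (hclosed : IsClosed E) (hsub : E ⊆ Ioo f.left f.right \ {f.crit})
    (hmap : ∀ z ∈ E, f.map z ∈ E)
    (hpre : ∀ z ∈ Ioo f.left f.right \ {f.crit}, f.map z ∈ E → z ∈ E) :
    f.IsProperCompletelyInvariant E where
  nonempty := hne
  isClosed := hclosed
  subset := hsub
  image_eq := by
    refine subset_antisymm (image_subset_iff.2 hmap) fun t ht => ?_
    suffices ∃ u ∈ Ioo f.left f.right \ {f.crit}, f.map u = t by
      obtain ⟨u, hu, rfl⟩ := this
      exact ⟨u, hpre u hu ht, rfl⟩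
    obtain ⟨htI, -⟩ := hsub ht
    rcases lt_or_ge (f.map f.left) t with hlt | hge
    · obtain ⟨u, hu, rfl⟩ := hf.exists_left_preimage ⟨hlt.le, htI.2⟩
      exact ⟨u, ⟨⟨hu.1.lt_of_ne (by rintro rfl; exact hlt.false), hu.2.trans hf.lt_right⟩,
        hu.2.ne⟩, rfl⟩
    · have hlt := hge.trans_lt hover
      obtain ⟨u, hu, rfl⟩ := hf.exists_right_preimage ⟨htI.1, hlt.le⟩
      exact ⟨u, ⟨⟨hf.left_lt.trans hu.1, hu.2.lt_of_ne (by rintro rfl; exact hlt.false)⟩,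
        hu.1.ne'⟩, rfl⟩
  preimage_eq := subset_antisymm (fun z hz => hpre z hz.1 hz.2) fun z hz => ⟨hsub hz, hmap z hz⟩

/-- `E` is a proper completely invariant closed set, `e₀` and `e₁` are its extreme points, and `x`
and `y` are its points next to the critical point. -/
structure Frame (f : LorenzData) (E : Set ℝ) (e₀ e₁ x y : ℝ) : Prop extends
    f.IsProperCompletelyInvariant E where
  least : IsLeast E e₀
  greatest : IsGreatest E e₁
  left : IsGreatest (E ∩ Iio f.crit) x
  right : IsLeast (E ∩ Ioi f.crit) y

lemma isLeast_neg {S : Set ℝ} (h : IsGreatest S x) : IsLeast (-S) (-x) :=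
  ⟨neg_mem_neg.2 h.1, fun _ hz => neg_le.1 (h.2 hz)⟩

lemma isGreatest_neg {S : Set ℝ} (h : IsLeast S x) : IsGreatest (-S) (-x) :=
  ⟨neg_mem_neg.2 h.1, fun _ hz => le_neg.1 (h.2 hz)⟩

lemma IsProperCompletelyInvariant.exists_isGreatest_left (hE : f.IsProperCompletelyInvariant E)
    (hf : f.IsExpanding) : ∃ x, IsGreatest (E ∩ Iio f.crit) x := by
  have heq : E ∩ Iio f.crit = E ∩ Iic f.crit := by
    ext z
    exact and_congr_right fun hz => (hE.ne_crit hz).le_iff_lt.symm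
  rw [heq]
  refine (hE.isCompact.inter_right isClosed_Iic).exists_isGreatest ?_
  rw [← heq]
  obtain ⟨e, he⟩ := hE.isCompact.exists_isGreatest hE.nonempty
  obtain ⟨w, hw, rfl⟩ := hE.exists_preimage he.1
  refine ⟨w, hw, mem_Iio.2 (lt_of_not_ge fun h => (he.2 hw).not_gt ?_)⟩
  exact (hf.map_lt_self ⟨h.lt_of_ne (hE.ne_crit hw).symm, (hE.mem_Ioo hw).2⟩)

lemma IsProperCompletelyInvariant.exists_frame (hE : f.IsProperCompletelyInvariant E)
    (hf : f.IsExpanding) : ∃ e₀ e₁ x y, f.Frame E e₀ e₁ x y := by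
  obtain ⟨e₀, h₀⟩ := hE.isCompact.exists_isLeast hE.nonempty
  obtain ⟨e₁, h₁⟩ := hE.isCompact.exists_isGreatest hE.nonempty
  obtain ⟨x, hx⟩ := hE.exists_isGreatest_left hf
  obtain ⟨y, hy⟩ := hE.reflect.exists_isGreatest_left hf.reflect
  refine ⟨e₀, e₁, x, -y, hE, h₀, h₁, hx, ?_⟩
  simpa only [LorenzData.reflect, inter_neg, neg_neg, neg_Iio] using isLeast_neg hy

lemma reflect_minimalPeriod (z : ℝ) :
    Function.minimalPeriod f.reflect.map (-z) = Function.minimalPeriod f.map z := by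
  refine Function.minimalPeriod_eq_minimalPeriod_iff.2 fun n => ?_
  simp only [Function.IsPeriodicPt, Function.IsFixedPt, reflect_map_iterate, neg_neg, neg_inj]

namespace Frame

variable (h : f.Frame E e₀ e₁ x y)
include h

lemma reflect : f.reflect.Frame (-E) (-e₁) (-e₀) (-y) (-x) where
  toIsProperCompletelyInvariant := h.toIsProperCompletelyInvariant.reflect
  least := isLeast_neg h.greatest
  greatest := isGreatest_neg h.least
  left := by simpa only [LorenzData.reflect, inter_neg, neg_Ioi] using isGreatest_neg h.right
  right := by simpa only [LorenzData.reflect, inter_neg, neg_Iio] using isLeast_neg h.left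

lemma least_mem : e₀ ∈ E := h.least.1

lemma greatest_mem : e₁ ∈ E := h.greatest.1

lemma left_mem : x ∈ E := h.left.1.1

lemma right_mem : y ∈ E := h.right.1.1

lemma left_lt_crit : x < f.crit := h.left.1.2

lemma crit_lt_right : f.crit < y := h.right.1.2

lemma le_left (hz : z ∈ E) (hzc : z < f.crit) : z ≤ x := h.left.2 ⟨hz, hzc⟩

lemma right_le (hz : z ∈ E) (hzc : f.crit < z) : y ≤ z := h.right.2 ⟨hz, hzc⟩

lemma least_le (hz : z ∈ E) : e₀ ≤ z := h.least.2 hz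

lemma le_greatest (hz : z ∈ E) : z ≤ e₁ := h.greatest.2 hz

lemma disjoint_Ioo : Disjoint E (Ioo x y) := by
  refine disjoint_left.2 fun z hz hxy => ?_
  rcases lt_or_gt_of_ne (h.ne_crit hz) with hzc | hzc
  · exact (h.le_left hz hzc).not_gt hxy.1
  · exact (h.right_le hz hzc).not_gt hxy.2

lemma mem_Icc_of_mem_Ico (hz : z ∈ Ico x f.crit) (hf : f.IsLorenz) : z ∈ Icc f.left f.right :=
  ⟨(h.mem_Icc h.left_mem).1.trans hz.1, (hz.2.trans hf.lt_right).le⟩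

lemma map_left (hf : f.IsExpanding) : f.map x = e₁ := by
  refine (h.le_greatest (h.map_mem h.left_mem)).antisymm ?_
  obtain ⟨w, hw, rfl⟩ := h.exists_preimage h.greatest_mem
  have hwc : w < f.crit := lt_of_not_ge fun hwc => (h.le_greatest hw).not_gt
    (hf.map_lt_self ⟨hwc.lt_of_ne (h.ne_crit hw).symm, (h.mem_Ioo hw).2⟩)
  exact (hf.iterate_le_iterate_iff (n := 1) (h.mem_Icc hw) (h.mem_Icc h.left_mem)
    (sameItin_one.2 (Or.inl ⟨hwc, h.left_lt_crit⟩))).2 (h.le_left hw hwc)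

lemma map_right (hf : f.IsExpanding) : f.map y = e₀ := by
  have hmap := h.reflect.map_left hf.reflect
  rwa [LorenzData.reflect, neg_inj, neg_neg] at hmap

lemma least_le_map_left (hf : f.IsExpanding) : e₀ ≤ f.map f.left := by
  by_contra! hlt
  obtain ⟨w, hw, hwe⟩ := hf.exists_left_preimage ⟨hlt.le, (h.mem_Ioo h.least_mem).2⟩
  have hlw : f.left < w := hw.1.lt_of_ne (by rintro rfl; exact hlt.ne hwe)
  have hwE : w ∈ E :=
    h.mem_of_map_mem ⟨⟨hlw, hw.2.trans hf.lt_right⟩, hw.2.ne⟩ (hwe ▸ h.least_mem)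
  exact (h.least_le hwE).not_gt (hwe ▸ hf.self_lt_map ⟨hlw, hw.2⟩)

/-- The critical point belongs to the image of an interval `[x, z]` first after a return of `x`, as
the image of `(x, z)` avoids `E`. -/
lemma exists_sameItin_iterate_eq (hf : f.IsExpanding) (hz : z ∈ Ioo x f.crit) :
    ∃ n ≠ 0, f.SameItin n x z ∧ f.map^[n] x = x ∧ f.crit ≤ f.map^[n] z := by
  have hxI := h.mem_Icc h.left_mem
  have hzI := h.mem_Icc_of_mem_Ico ⟨hz.1.le, hz.2⟩ hf.toIsLorenz
  obtain ⟨n, hn, hcrit⟩ := hf.exists_crit_mem_Icc hxI hzI hz.1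
  have hnE := h.iterate_mem h.left_mem n
  have hlt : f.map^[n] x < f.crit := hcrit.1.lt_of_ne (h.ne_crit hnE)
  refine ⟨n, ?_, hn, (h.le_left hnE hlt).antisymm (not_lt.1 fun hlt' => ?_), hcrit.2⟩
  · rintro rfl
    exact hz.2.not_ge hcrit.2
  · have hdisj := h.disjoint_Ioo_iterate hf.toIsLorenz hxI hzI hn
      (h.disjoint_Ioo.mono_right (Ioo_subset_Ioo_right (hz.2.trans h.crit_lt_right).le))
    exact disjoint_left.1 hdisj h.left_mem ⟨hlt', h.left_lt_crit.trans_le hcrit.2⟩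

lemma left_mem_periodicPts (hf : f.IsExpanding) : x ∈ Function.periodicPts f.map := by
  obtain ⟨z, hz⟩ := exists_between h.left_lt_crit
  obtain ⟨n, hn, -, hper, -⟩ := h.exists_sameItin_iterate_eq hf hz
  exact Function.mk_mem_periodicPts (Nat.pos_of_ne_zero hn) hper

lemma right_mem_periodicPts (hf : f.IsExpanding) : y ∈ Function.periodicPts f.map := by
  have hper := h.reflect.left_mem_periodicPts hf.reflect
  rwa [← Function.minimalPeriod_pos_iff_mem_periodicPts, reflect_minimalPeriod,
    Function.minimalPeriod_pos_iff_mem_periodicPts] at hper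

lemma sameItin_left (hf : f.IsExpanding) (hz : z ∈ Ico x f.crit) :
    f.SameItin (Function.minimalPeriod f.map x) x z := by
  obtain ⟨w, hzw, hwc⟩ := exists_between hz.2
  obtain ⟨n, hn, hxw, hper, -⟩ := h.exists_sameItin_iterate_eq hf ⟨hz.1.trans_lt hzw, hwc⟩
  have hle : Function.minimalPeriod f.map x ≤ n :=
    Function.IsPeriodicPt.minimalPeriod_le (Nat.pos_of_ne_zero hn) hper
  exact (hf.sameItin_of_mem_Icc (h.mem_Icc h.left_mem) (h.mem_Icc_of_mem_Ico
    ⟨hz.1.trans hzw.le, hwc⟩ hf.toIsLorenz) hxw ⟨hz.1, hzw.le⟩).mono hle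

lemma sameItin_right (hf : f.IsExpanding) (hz : z ∈ Ioc f.crit y) :
    f.SameItin (Function.minimalPeriod f.map y) y z := by
  have hsame := h.reflect.sameItin_left hf.reflect (z := -z) ⟨neg_le_neg hz.2, neg_lt_neg hz.1⟩
  rwa [reflect_minimalPeriod, reflect_sameItin, neg_neg, neg_neg] at hsame

lemma iterate_left_mem_Ico (hf : f.IsExpanding) (hz : z ∈ Ico x f.crit) :
    f.map^[Function.minimalPeriod f.map x] z ∈ Ico x y := by
  obtain ⟨w, hzw, hwc⟩ := exists_between hz.2
  have hw : w ∈ Ico x f.crit := ⟨hz.1.trans hzw.le, hwc⟩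
  have hxI := h.mem_Icc h.left_mem
  have hzI := h.mem_Icc_of_mem_Ico hz hf.toIsLorenz
  have hwI := h.mem_Icc_of_mem_Ico hw hf.toIsLorenz
  have hxz := h.sameItin_left hf hz
  have hxw := h.sameItin_left hf hw
  have hle := (hf.iterate_le_iterate_iff hxI hzI hxz).2 hz.1
  have hlt := (hf.iterate_lt_iterate_iff hzI hwI (hxz.symm.trans hxw)).2 hzw
  have hdisj := h.disjoint_Ioo_iterate hf.toIsLorenz hxI hwI hxw
    (h.disjoint_Ioo.mono_right (Ioo_subset_Ioo_right (hwc.trans h.crit_lt_right).le))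
  rw [Function.iterate_minimalPeriod] at hle hdisj
  exact ⟨hle, hlt.trans_le (not_lt.1 fun hy => disjoint_left.1 hdisj h.right_mem
    ⟨h.left_lt_crit.trans h.crit_lt_right, hy⟩)⟩

lemma iterate_right_mem_Ioc (hf : f.IsExpanding) (hz : z ∈ Ioc f.crit y) :
    f.map^[Function.minimalPeriod f.map y] z ∈ Ioc x y := by
  have hmem := h.reflect.iterate_left_mem_Ico hf.reflect (z := -z)
    ⟨neg_le_neg hz.2, neg_lt_neg hz.1⟩
  rw [reflect_minimalPeriod, reflect_map_iterate, neg_neg] at hmem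
  exact ⟨neg_lt_neg_iff.1 hmem.2, neg_le_neg_iff.1 hmem.1⟩

end Frame

/-! ### The multipliers of the boundary orbits -/

/-- The slope along the whole orbit of a periodic point `x`. -/
noncomputable def multiplier (f : LorenzData) (a b x : ℝ) : ℝ :=
  f.iterSlope a b (Function.minimalPeriod f.map x) x

lemma reflect_multiplier (hc : ∀ i, f.map^[i] z ≠ f.crit) :
    f.reflect.multiplier b a (-z) = f.multiplier a b z := by
  rw [multiplier, reflect_minimalPeriod, reflect_iterSlope fun i _ => hc i, multiplier]

lemma IsPwLinear.multiplier_iterate (hf : f.IsPwLinear a b) (hz : z ∈ Function.periodicPts f.map)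
    (k : ℕ) : f.multiplier a b (f.map^[k] z) = f.multiplier a b z := by
  refine mul_right_cancel₀ (hf.iterSlope_pos k z).ne' ?_
  rw [multiplier, Function.minimalPeriod_apply_iterate hz, ← iterSlope_add, add_comm, iterSlope_add,
    Function.iterate_minimalPeriod, mul_comm, multiplier]

namespace Frame

variable (h : f.Frame E e₀ e₁ x y) (hf : f.IsPwLinear a b)
include h hf

lemma one_lt_multiplier_left : 1 < f.multiplier a b x :=
  hf.one_lt_iterSlope (h.mem_Icc h.left_mem) (h.iterate_ne_crit h.left_mem)
    (Function.minimalPeriod_pos_of_mem_periodicPts (h.left_mem_periodicPts hf.isExpanding)).ne'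
    Function.iterate_minimalPeriod

lemma iterate_left_eq (hz : z ∈ Ico x f.crit) :
    f.map^[Function.minimalPeriod f.map x] z = x + f.multiplier a b x * (z - x) := by
  have hsub := hf.iterate_sub_iterate (h.mem_Icc h.left_mem) (h.mem_Icc_of_mem_Ico hz hf.toIsLorenz)
    (h.sameItin_left hf.isExpanding hz)
  rwa [Function.iterate_minimalPeriod, sub_eq_iff_eq_add'] at hsub

lemma multiplier_left_mul_le : f.multiplier a b x * (f.crit - x) ≤ y - x := by
  have hA := one_pos.trans (h.one_lt_multiplier_left hf)
  by_contra! hlt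
  rw [← div_lt_iff₀' hA, lt_sub_iff_add_lt'] at hlt
  have hz : x + (y - x) / f.multiplier a b x ∈ Ico x f.crit := ⟨le_add_of_nonneg_right
    (div_pos (sub_pos.2 (h.left_lt_crit.trans h.crit_lt_right)) hA).le, hlt⟩
  have hmem := (h.iterate_left_mem_Ico hf.isExpanding hz).2
  rw [h.iterate_left_eq hf hz, add_sub_cancel_left, mul_div_cancel₀ _ hA.ne',
    add_sub_cancel] at hmem
  exact hmem.false

lemma one_lt_multiplier_right : 1 < f.multiplier a b y := by
  have hone := h.reflect.one_lt_multiplier_left hf.reflect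
  rwa [reflect_multiplier (h.iterate_ne_crit h.right_mem)] at hone

lemma multiplier_right_mul_le : f.multiplier a b y * (y - f.crit) ≤ y - x := by
  have hle := h.reflect.multiplier_left_mul_le hf.reflect
  rw [reflect_multiplier (h.iterate_ne_crit h.right_mem)] at hle
  simpa only [LorenzData.reflect, neg_sub_neg] using hle

lemma iterate_right_eq (hz : z ∈ Ioc f.crit y) :
    f.map^[Function.minimalPeriod f.map y] z = y - f.multiplier a b y * (y - z) := by
  have heq := h.reflect.iterate_left_eq hf.reflect (z := -z) ⟨neg_le_neg hz.2, neg_lt_neg hz.1⟩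
  rw [reflect_minimalPeriod, reflect_map_iterate, neg_neg,
    reflect_multiplier (h.iterate_ne_crit h.right_mem)] at heq
  linarith

/-- The images of `(x, crit)` and `(crit, y)` under the return maps lie in `(x, y)`. -/
lemma one_le_inv_multiplier_add_inv_multiplier :
    1 ≤ (f.multiplier a b x)⁻¹ + (f.multiplier a b y)⁻¹ := by
  have hA := one_pos.trans (h.one_lt_multiplier_left hf)
  have hB := one_pos.trans (h.one_lt_multiplier_right hf)
  have hxy : 0 < y - x := sub_pos.2 (h.left_lt_crit.trans h.crit_lt_right)
  have hleft := (le_div_iff₀' hA).2 (h.multiplier_left_mul_le hf)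
  have hright := (le_div_iff₀' hB).2 (h.multiplier_right_mul_le hf)
  rw [← mul_le_mul_iff_right₀ hxy, mul_add, ← div_eq_mul_inv, ← div_eq_mul_inv]
  linarith

end Frame

end CompletelyInvariantSets

/-! ### The extreme points of a completely invariant set -/

section ExtremePoints

variable {f : LorenzData} {a b : ℝ} {E : Set ℝ} {k k' r ℓ : ℕ}
  {e e₀ e₁ s s' t u v v' x y z : ℝ}

lemma exists_iterate_iterate_eq (hx : x ∈ Function.periodicPts f.map) (n : ℕ) :
    ∃ i, f.map^[n] (f.map^[i] x) = x := by
  have hpos := Function.minimalPeriod_pos_of_mem_periodicPts hx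
  refine ⟨n * Function.minimalPeriod f.map x - n, ?_⟩
  rw [← Function.iterate_add_apply, Nat.add_sub_cancel' (Nat.le_mul_of_pos_right n hpos)]
  exact (Function.isPeriodicPt_minimalPeriod f.map x).const_mul n

lemma exists_preimage_mem_orbit (hx : x ∈ Function.periodicPts f.map)
    (hv : ∃ j, f.map^[j] x = v) : ∃ u, (∃ j, f.map^[j] x = u) ∧ f.map u = v := by
  obtain ⟨j, rfl⟩ := hv
  obtain ⟨i, hi⟩ := exists_iterate_iterate_eq hx 1
  refine ⟨_, ⟨j + i, rfl⟩, ?_⟩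
  rw [← Function.iterate_succ_apply' f.map, ← Nat.add_succ, Function.iterate_add_apply]
  exact congrArg _ ((Function.iterate_succ_apply' _ _ _).trans hi)

lemma finite_range_iterate (hx : x ∈ Function.periodicPts f.map) :
    (range fun i : ℕ => f.map^[i] x).Finite := by
  refine ((finite_Iio (Function.minimalPeriod f.map x)).image fun i => f.map^[i] x).subset ?_
  rintro _ ⟨i, rfl⟩
  exact ⟨_, Nat.mod_lt i (Function.minimalPeriod_pos_of_mem_periodicPts hx),
    Function.iterate_mod_minimalPeriod_eq⟩

lemma injOn_iterate_periodicPts (k : ℕ) : InjOn f.map^[k] (Function.periodicPts f.map) :=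
  (Function.bijOn_periodicPts f.map).injOn.iterate (Function.bijOn_periodicPts f.map).mapsTo k

lemma iterate_mem_periodicPts (hx : x ∈ Function.periodicPts f.map) (i : ℕ) :
    f.map^[i] x ∈ Function.periodicPts f.map :=
  (Function.bijOn_periodicPts f.map).mapsTo.iterate i hx

/-- The preimages of `[e, t]` under `f^ℓ` and `f^r` adjacent to `t` and to `e` are disjoint parts of
`[e, t]`, whose lengths are proportional to the inverse slopes. -/
lemma IsPwLinear.inv_iterSlope_add_inv_iterSlope_lt_one (hf : f.IsPwLinear a b)
    (he : e ∈ Icc f.left f.right) (ht : t ∈ Icc f.left f.right) (hs : s ∈ Icc f.left f.right)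
    (hu : u ∈ Icc f.left f.right) (het : e < t) (hst : f.SameItin ℓ s t) (hs_eq : f.map^[ℓ] s = e)
    (ht_eq : f.map^[ℓ] t = t) (hℓ : 0 < ℓ) (heu : f.SameItin r e u) (he_eq : f.map^[r] e = e)
    (hu_eq : f.map^[r] u = t) (hr : 0 < r) :
    (f.iterSlope a b ℓ t)⁻¹ + (f.iterSlope a b r e)⁻¹ < 1 := by
  obtain ⟨n, hn, hcrit⟩ := hf.isExpanding.exists_crit_mem_Icc he ht het
  have hst' : f.SameItin (n + ℓ) s t := hst.add (by rwa [hs_eq, ht_eq])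
  have heu' : f.SameItin (n + r) e u := heu.add (by rwa [he_eq, hu_eq])
  have hus : u < s := by
    have hitin : f.SameItin n u s := ((heu'.mono (by omega)).symm.trans hn).trans
      (hst'.mono (by omega)).symm
    rw [← hf.iterate_lt_iterate_iff hu hs hitin]
    have hsn := hst' n (by omega)
    have hun := heu' n (by omega)
    unfold SameSide at hsn hun
    grind
  have hleft := hf.iterate_sub_iterate ht hs hst.symm
  have hright := hf.iterate_sub_iterate he hu heu
  rw [hs_eq, ht_eq, ← inv_mul_eq_iff_eq_mul₀ (hf.iterSlope_pos ℓ t).ne'] at hleft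
  rw [he_eq, hu_eq, ← inv_mul_eq_iff_eq_mul₀ (hf.iterSlope_pos r e).ne'] at hright
  rw [← mul_lt_mul_iff_left₀ (sub_pos.2 het), add_mul, hright]
  linarith

/-- The point `z` has the itinerary of the point `v` of the orbit of `x` until `v` arrives at `x`,
at time `k`. -/
structure Shadows (f : LorenzData) (x : ℝ) (k : ℕ) (z v : ℝ) : Prop where
  sameItin : f.SameItin k z v
  iterate_eq : f.map^[k] v = x
  mem_orbit : ∃ j, f.map^[j] x = v

lemma Shadows.reflect (h : f.Shadows x k z v) : f.reflect.Shadows (-x) k (-z) (-v) where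
  sameItin := by rw [reflect_sameItin, neg_neg, neg_neg]; exact h.sameItin
  iterate_eq := by rw [reflect_map_iterate, neg_neg, h.iterate_eq]
  mem_orbit := h.mem_orbit.imp fun j hj => by rw [reflect_map_iterate, neg_neg, hj]

lemma Shadows.cons (h : f.Shadows x k (f.map z) (f.map v)) (hzv : f.SameSide z v)
    (hv : ∃ j, f.map^[j] x = v) : f.Shadows x (k + 1) z v where
  sameItin := (sameItin_one.2 hzv).add h.sameItin
  iterate_eq := h.iterate_eq
  mem_orbit := hv

/-- The interval `[e, v]`, mapped by `f^k` to an interval ending in the periodic point `x` of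
period `ℓ`, has the preimage `[s, v]` under `f^ℓ`. -/
structure ReturnBranch (f : LorenzData) (e x : ℝ) (k : ℕ) (v s : ℝ) : Prop extends
    f.Shadows x k e v where
  mem : s ∈ Icc f.left f.right
  sameItin_return : f.SameItin (Function.minimalPeriod f.map x) s v
  iterate_return : f.map^[Function.minimalPeriod f.map x] s = e

lemma ReturnBranch.reflect (h : f.ReturnBranch e x k v s) :
    f.reflect.ReturnBranch (-e) (-x) k (-v) (-s) where
  toShadows := h.toShadows.reflect
  mem := ⟨neg_le_neg h.mem.2, neg_le_neg h.mem.1⟩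
  sameItin_return := by
    rw [reflect_minimalPeriod, reflect_sameItin, neg_neg, neg_neg]
    exact h.sameItin_return
  iterate_return := by rw [reflect_minimalPeriod, reflect_map_iterate, neg_neg, h.iterate_return]

lemma reflect_reflect (f : LorenzData) : f.reflect.reflect = f := by
  simp only [LorenzData.reflect, neg_neg]

lemma ReturnBranch.of_reflect (h : f.reflect.ReturnBranch (-e) (-x) k v s) :
    f.ReturnBranch e x k (-v) (-s) := by
  simpa only [reflect_reflect, neg_neg] using h.reflect

namespace Frame

variable (h : f.Frame E e₀ e₁ x y)
include h

lemma iterate_left_mem (i : ℕ) : f.map^[i] x ∈ E := h.iterate_mem h.left_mem i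

/-- If `s` has no preimage on the branch of the preimage `u` of `v`, then `s < f e₀ ≤ v`, and `e₀`
shadows `u` better than `s` shadows `v`. -/
lemma exists_preimage_shadows (hf : f.IsExpanding) (hs : s ∈ E) (hsv : f.Shadows x k s v)
    (hsx : f.map^[k] s ≤ x)
    (hmax : ∀ k' v', f.Shadows x k' e₀ v' → f.map^[k'] e₀ ≤ f.map^[k] s) :
    ∃ s' ∈ E, ∃ u, f.map s' = s ∧ f.Shadows x (k + 1) s' u := by
  obtain ⟨u, hu, rfl⟩ := exists_preimage_mem_orbit (h.left_mem_periodicPts hf) hsv.mem_orbit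
  have huE : u ∈ E := hu.choose_spec ▸ h.iterate_left_mem _
  have hvE := h.map_mem huE
  have hle : s ≤ f.map u := (hf.iterate_le_iterate_iff (h.mem_Icc hs) (h.mem_Icc hvE)
    hsv.sameItin).1 (hsx.trans_eq hsv.iterate_eq.symm)
  rcases lt_or_gt_of_ne (h.ne_crit huE) with huc | huc
  · have hec : e₀ < f.crit := (h.least_le huE).trans_lt huc
    rcases lt_or_ge (f.map f.left) s with hlt | hge
    · obtain ⟨s', hs', rfl⟩ := hf.exists_left_preimage ⟨hlt.le, (h.mem_Ioo hs).2⟩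
      have hls' : f.left < s' := hs'.1.lt_of_ne (by rintro rfl; exact hlt.false)
      exact ⟨s', h.mem_of_map_mem ⟨⟨hls', hs'.2.trans hf.lt_right⟩, hs'.2.ne⟩ hs, u, rfl,
        hsv.cons (Or.inl ⟨hs'.2, huc⟩) hu⟩
    have hI := h.mem_Icc h.least_mem
    have hlt : s < f.map e₀ := hge.trans_lt (hf.strictMonoOn_left ⟨le_rfl, hf.left_lt⟩
      ⟨hI.1, hec⟩ (h.mem_Ioo h.least_mem).1)
    have hle' : f.map e₀ ≤ f.map u := (hf.strictMonoOn_left.le_iff_le ⟨hI.1, hec⟩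
      ⟨(h.mem_Icc huE).1, huc⟩).2 (h.least_le huE)
    have hitin := hf.sameItin_of_mem_Icc (h.mem_Icc hs) (h.mem_Icc hvE) hsv.sameItin ⟨hlt.le, hle'⟩
    have hshadow : f.Shadows x k (f.map e₀) (f.map u) :=
      ⟨hitin.symm.trans hsv.sameItin, hsv.iterate_eq, hsv.mem_orbit⟩
    exact absurd (hmax _ _ (hshadow.cons (Or.inl ⟨hec, huc⟩) hu)) (not_le.2
      ((hf.iterate_lt_iterate_iff (h.mem_Icc hs) (h.mem_Icc (h.map_mem h.least_mem)) hitin).2 hlt))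
  · have hlt : s < f.map f.right := hle.trans_lt (hf.strictMonoOn_right
      ⟨huc, (h.mem_Icc huE).2⟩ ⟨hf.lt_right, le_rfl⟩ (h.mem_Ioo huE).2)
    obtain ⟨s', hs', rfl⟩ := hf.exists_right_preimage ⟨(h.mem_Ioo hs).1, hlt.le⟩
    have hs'r : s' < f.right := hs'.2.lt_of_ne (by rintro rfl; exact hlt.false)
    exact ⟨s', h.mem_of_map_mem ⟨⟨hf.left_lt.trans hs'.1, hs'r⟩, hs'.1.ne'⟩ hs, u, rfl,
      hsv.cons (Or.inr ⟨hs'.1, huc⟩) hu⟩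

lemma exists_shadows_isGreatest (hf : f.IsExpanding) :
    ∃ k v, f.Shadows x k e₀ v ∧ ∀ k' v', f.Shadows x k' e₀ v' → f.map^[k'] e₀ ≤ f.map^[k] e₀ := by
  have hfin : {w | ∃ k v, f.Shadows x k e₀ v ∧ f.map^[k] e₀ = w}.Finite := by
    have hper : e₀ ∈ Function.periodicPts f.map := by
      rw [← h.map_right hf]
      exact iterate_mem_periodicPts (h.right_mem_periodicPts hf) 1
    refine (finite_range_iterate hper).subset ?_
    rintro _ ⟨k, -, -, rfl⟩
    exact ⟨k, rfl⟩
  obtain ⟨_, ⟨k, v, hk, rfl⟩, hmax⟩ := exists_max_image _ id hfin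
    ⟨e₀, 0, x, ⟨SameItin.zero _ _, rfl, 0, rfl⟩, rfl⟩
  exact ⟨k, v, hk, fun k' v' hk' => hmax _ ⟨k', v', hk', rfl⟩⟩

lemma exists_returnBranch_left (hf : f.IsExpanding) : ∃ k v s, f.ReturnBranch e₀ x k v s := by
  obtain ⟨k, v, hv, hmax⟩ := h.exists_shadows_isGreatest hf
  have hvE : v ∈ E := hv.mem_orbit.choose_spec ▸ h.iterate_left_mem _
  have hle : f.map^[k] e₀ ≤ x := hv.iterate_eq ▸ (hf.iterate_le_iterate_iff
    (h.mem_Icc h.least_mem) (h.mem_Icc hvE) hv.sameItin).2 (h.least_le hvE)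
  have hchain : ∀ t, ∃ s ∈ E, ∃ u, f.Shadows x t s u ∧ f.map^[t] s = f.map^[k] e₀ := by
    intro t
    induction t with
    | zero => exact ⟨_, h.iterate_mem h.least_mem k, x, ⟨SameItin.zero _ _, rfl, 0, rfl⟩, rfl⟩
    | succ t ih =>
      obtain ⟨s, hs, u, hu, hsk⟩ := ih
      obtain ⟨s', hs', u', rfl, hu'⟩ := h.exists_preimage_shadows hf hs hu (hsk ▸ hle) (hsk ▸ hmax)
      exact ⟨s', hs', u', hu', hsk⟩
  have hper := h.left_mem_periodicPts hf
  obtain ⟨s, hs, u, hu, hsk⟩ := hchain (k + Function.minimalPeriod f.map x)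
  have huper : f.map^[Function.minimalPeriod f.map x] u = u := by
    obtain ⟨i, rfl⟩ := hu.mem_orbit
    exact (Function.isPeriodicPt_minimalPeriod f.map x).apply_iterate i
  obtain rfl : u = v := by
    obtain ⟨i, hi⟩ := hu.mem_orbit
    obtain ⟨j, hj⟩ := hv.mem_orbit
    refine injOn_iterate_periodicPts k (hi ▸ iterate_mem_periodicPts hper i)
      (hj ▸ iterate_mem_periodicPts hper j) (Eq.trans ?_ hv.iterate_eq.symm)
    rw [← hu.iterate_eq, Function.iterate_add_apply, huper]
  refine ⟨k, u, s, hv, h.mem_Icc hs, hu.sameItin.mono (by omega), ?_⟩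
  have hsu : f.SameItin k (f.map^[Function.minimalPeriod f.map x] s) u := by
    simpa only [huper] using hu.sameItin.iterate
  rw [Function.iterate_add_apply] at hsk
  have hsame := hv.sameItin.trans hsu.symm
  have hI := h.mem_Icc (h.iterate_mem hs (Function.minimalPeriod f.map x))
  exact ((hf.iterate_le_iterate_iff hI (h.mem_Icc h.least_mem) hsame.symm).1 hsk.le).antisymm
    ((hf.iterate_le_iterate_iff (h.mem_Icc h.least_mem) hI hsame).1 hsk.ge)

lemma exists_returnBranch_right (hf : f.IsExpanding) : ∃ k v s, f.ReturnBranch e₁ y k v s := by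
  obtain ⟨k, v, s, hb⟩ := h.reflect.exists_returnBranch_left hf.reflect
  exact ⟨k, -v, -s, hb.of_reflect⟩

lemma sameItin_succ_left (hf : f.IsLorenz) (hv : f.Shadows x k e₀ v) :
    f.SameItin (k + 1) e₀ v := by
  have hvE : v ∈ E := hv.mem_orbit.choose_spec ▸ h.iterate_left_mem _
  have hle := (hf.iterate_le_iterate_iff (h.mem_Icc h.least_mem) (h.mem_Icc hvE) hv.sameItin).2
    (h.least_le hvE)
  rw [hv.iterate_eq] at hle
  exact hv.sameItin.succ (Or.inl ⟨hle.trans_lt h.left_lt_crit, hv.iterate_eq ▸ h.left_lt_crit⟩)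

lemma sameItin_succ_right (hf : f.IsLorenz) (hv : f.Shadows y k e₁ v) :
    f.SameItin (k + 1) e₁ v := by
  simpa only [reflect_sameItin, neg_neg] using h.reflect.sameItin_succ_left hf.reflect hv.reflect

lemma isPeriodicPt_least (hf : f.IsExpanding) :
    f.map^[Function.minimalPeriod f.map y] e₀ = e₀ := by
  rw [← h.map_right hf]
  exact (Function.isPeriodicPt_minimalPeriod f.map y).apply_iterate 1

lemma iterSlope_least (hf : f.IsPwLinear a b) :
    f.iterSlope a b (Function.minimalPeriod f.map y) e₀ = f.multiplier a b y := by
  have hyper := h.right_mem_periodicPts hf.isExpanding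
  have hmult := hf.multiplier_iterate hyper 1
  rwa [multiplier, Function.minimalPeriod_apply_iterate hyper, Function.iterate_one,
    h.map_right hf.isExpanding] at hmult

/-- The witness is the image of `s'` under `f^(k'+1)`. -/
lemma exists_sameItin_least (hf : f.IsExpanding) (hv' : f.ReturnBranch e₁ y k' v' s') :
    ∃ t ∈ Icc f.left f.right, f.SameItin (Function.minimalPeriod f.map y) e₀ t ∧
      f.map^[Function.minimalPeriod f.map y] t = f.map^[k' + 1] e₁ := by
  have hv'per : f.map^[Function.minimalPeriod f.map y] v' = v' := by
    obtain ⟨j, rfl⟩ := hv'.mem_orbit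
    exact (Function.isPeriodicPt_minimalPeriod f.map y).apply_iterate j
  have hv'_eq : f.map^[k' + 1] v' = e₀ := by
    rw [Function.iterate_succ_apply', hv'.iterate_eq, h.map_right hf]
  have hlong : f.SameItin (Function.minimalPeriod f.map y + (k' + 1)) v' s' := by
    rw [add_comm]
    refine hv'.sameItin_return.symm.add ?_
    rw [hv'per, hv'.iterate_return]
    exact (h.sameItin_succ_right hf.toIsLorenz hv'.toShadows).symm
  refine ⟨f.map^[k' + 1] s', hf.iterate_mem_Icc hv'.mem (hlong.symm.mono (by omega)).ne_crit,
    hv'_eq ▸ hlong.iterate, ?_⟩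
  rw [← Function.iterate_add_apply, Nat.add_comm, Function.iterate_add_apply, hv'.iterate_return]

/-- Otherwise `[e₀, v]` has a preimage adjacent to `e₀`, and one adjacent to `v`, namely `[s, v]`.
The slopes on them violate `one_le_inv_multiplier_add_inv_multiplier`. -/
lemma iterate_greatest_lt (hf : f.IsPwLinear a b) (hv : f.ReturnBranch e₀ x k v s)
    (hv' : f.ReturnBranch e₁ y k' v' s') (hlt : e₀ < v) : f.map^[k' + 1] e₁ < v := by
  by_contra! hge
  have hxper := h.left_mem_periodicPts hf.isExpanding
  have hyper := h.right_mem_periodicPts hf.isExpanding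
  obtain ⟨j, rfl⟩ := hv.mem_orbit
  have heper := h.isPeriodicPt_least hf.isExpanding
  have hIe := h.mem_Icc h.least_mem
  obtain ⟨t, htI, het, ht_eq⟩ := h.exists_sameItin_least hf.isExpanding hv'
  have hle : e₀ ≤ t := (hf.iterate_le_iterate_iff hIe htI het).1
    (by rw [heper, ht_eq]; exact hlt.le.trans hge)
  obtain ⟨u, hu, hu_eq⟩ := hf.exists_iterate_eq hIe htI het hle
    (t := f.map^[j] x) ⟨by rw [heper]; exact hlt.le, by rw [ht_eq]; exact hge⟩
  refine (hf.inv_iterSlope_add_inv_iterSlope_lt_one hIe (h.mem_Icc (h.iterate_left_mem j)) hv.mem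
    ⟨hIe.1.trans hu.1, hu.2.trans htI.2⟩ hlt hv.sameItin_return hv.iterate_return
    ((Function.isPeriodicPt_minimalPeriod f.map x).apply_iterate j)
    (Function.minimalPeriod_pos_of_mem_periodicPts hxper)
    (hf.sameItin_of_mem_Icc hIe htI het hu) heper hu_eq
    (Function.minimalPeriod_pos_of_mem_periodicPts hyper)).not_ge ?_
  have hmult := hf.multiplier_iterate hxper j
  rw [multiplier, Function.minimalPeriod_apply_iterate hxper] at hmult
  rw [hmult, h.iterSlope_least hf]
  exact h.one_le_inv_multiplier_add_inv_multiplier hf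

lemma lt_iterate_least (hf : f.IsPwLinear a b) (hv : f.ReturnBranch e₀ x k v s)
    (hv' : f.ReturnBranch e₁ y k' v' s') (hlt : v' < e₁) : v' < f.map^[k + 1] e₀ := by
  have hlt' := h.reflect.iterate_greatest_lt hf.reflect hv'.reflect hv.reflect (neg_lt_neg hlt)
  rwa [reflect_map_iterate, neg_neg, neg_lt_neg_iff] at hlt'

theorem exists_iterate_left_eq_least (hf : f.IsPwLinear a b) : ∃ j, f.map^[j] x = e₀ := by
  by_contra! hne
  obtain ⟨k, v, s, hv⟩ := h.exists_returnBranch_left hf.isExpanding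
  obtain ⟨k', v', s', hv'⟩ := h.exists_returnBranch_right hf.isExpanding
  obtain ⟨j, hj⟩ := hv.mem_orbit
  obtain ⟨j', hj'⟩ := hv'.mem_orbit
  have hvE : v ∈ E := hj ▸ h.iterate_left_mem j
  have hv'E : v' ∈ E := hj' ▸ h.iterate_mem h.right_mem j'
  have hv_eq : f.map^[k + 1] v = e₁ := by
    rw [Function.iterate_succ_apply', hv.iterate_eq, h.map_left hf.isExpanding]
  have hv'_eq : f.map^[k' + 1] v' = e₀ := by
    rw [Function.iterate_succ_apply', hv'.iterate_eq, h.map_right hf.isExpanding]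
  have hlt : e₀ < v := (h.least_le hvE).lt_of_ne fun he => hne j (hj.trans he.symm)
  have hlt' : v' < e₁ := (h.le_greatest hv'E).lt_of_ne fun he => hne (k' + 1 + 1) <| by
    rw [Function.iterate_succ_apply, h.map_left hf.isExpanding, ← he, hv'_eq]
  have hmem : f.map^[k + 1] e₀ ∈ Icc v' e₁ :=
    ⟨(h.lt_iterate_least hf hv hv' hlt').le, h.le_greatest (h.iterate_mem h.least_mem _)⟩
  have hright := (h.sameItin_succ_right hf.toIsLorenz hv'.toShadows).symm
  have hmid := hf.sameItin_of_mem_Icc (h.mem_Icc hv'E) (h.mem_Icc h.greatest_mem) hright hmem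
  refine hf.isExpanding.not_sameItin_of_mapsTo_Icc (n := k' + 1 + (k + 1)) (h.mem_Icc h.least_mem)
    (h.mem_Icc hvE) hlt (Nat.succ_ne_zero _) (h.least_le (h.iterate_mem h.least_mem _)) ?_
    ((h.sameItin_succ_left hf.toIsLorenz hv.toShadows).add ?_)
  · rw [Function.iterate_add_apply, hv_eq]
    exact (h.iterate_greatest_lt hf hv hv' hlt).le
  · rw [hv_eq]
    exact hmid.symm.trans hright

end Frame

end ExtremePoints

/-! ### Minimal completely invariant sets -/

section InvariantCycles

variable {f : LorenzData} {a b : ℝ} {E E' O X : Set ℝ} {n : ℕ}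
  {e₀ e₁ e₀' e₁' v w x x' y y' z : ℝ}

namespace Frame

variable (h : f.Frame E e₀ e₁ x y)
include h

/-- Points of `E` near `v` follow `v` while it visits both extreme points of `E`, hence lie on
neither side of `v`. -/
lemma eventually_eq (hf : f.IsPwLinear a b) (hv : v ∈ E) (hvx : f.map^[n] v = x) :
    ∀ᶠ w in 𝓝 v, w ∈ E → w = v := by
  obtain ⟨j, hj⟩ := h.exists_iterate_left_eq_least hf
  have hleast : f.map^[j + n] v = e₀ := by rw [Function.iterate_add_apply, hvx, hj]
  have hgreatest : f.map^[n + 1] v = e₁ := by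
    rw [Function.iterate_succ_apply', hvx, h.map_left hf.isExpanding]
  filter_upwards [hf.eventually_sameItin (h.mem_Ioo hv) (n := j + n)
      fun i _ => h.iterate_ne_crit hv i,
    hf.eventually_sameItin (h.mem_Ioo hv) (n := n + 1) fun i _ => h.iterate_ne_crit hv i]
    with w hw₀ hw₁ hw
  refine le_antisymm ?_ ?_
  · rw [← hf.iterate_le_iterate_iff (h.mem_Icc hw) (h.mem_Icc hv) hw₁.symm, hgreatest]
    exact h.le_greatest (h.iterate_mem hw _)
  · rw [← hf.iterate_le_iterate_iff (h.mem_Icc hv) (h.mem_Icc hw) hw₀, hleast]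
    exact h.least_le (h.iterate_mem hw _)

lemma isProperCompletelyInvariant_of_ne (hf : f.IsPwLinear a b) (hz : z ∈ E)
    (hzx : ∀ n, f.map^[n] z ≠ x) :
    f.IsProperCompletelyInvariant {z ∈ E | ∀ n, f.map^[n] z ≠ x} := by
  refine hf.isProperCompletelyInvariant hf.overlap ⟨z, hz, hzx⟩ ?_ (fun v hv => h.subset hv.1)
    (fun v hv => ⟨h.map_mem hv.1, fun n => hv.2 (n + 1)⟩)
    fun v hv hfv => ⟨h.mem_of_map_mem hv hfv.1, fun n hn => ?_⟩
  · refine isClosed_of_closure_subset fun v hv => ?_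
    have hvE : v ∈ E := closure_minimal (fun _ hw => hw.1) h.isClosed hv
    refine ⟨hvE, fun n hn => ?_⟩
    obtain ⟨w, hw, hwS⟩ := (mem_closure_iff_frequently.1 hv).and_eventually
      (h.eventually_eq hf hvE hn) |>.exists
    exact hw.2 n (hwS hw.1 ▸ hn)
  · have hpos := Function.minimalPeriod_pos_of_mem_periodicPts
      (h.left_mem_periodicPts hf.isExpanding)
    refine hfv.2 (n + Function.minimalPeriod f.map x - 1) ?_
    rw [← Function.iterate_succ_apply, show (n + Function.minimalPeriod f.map x - 1).succ =
      Function.minimalPeriod f.map x + n by omega, Function.iterate_add_apply, hn,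
      Function.iterate_minimalPeriod]

theorem eq_orbit_of_minimal (hf : f.IsPwLinear a b)
    (hmin : ∀ E', f.IsProperCompletelyInvariant E' → E' ⊆ E → E ⊆ E') :
    E = range fun i : ℕ => f.map^[i] x := by
  have hall : ∀ z ∈ E, ∃ n, f.map^[n] z = x := by
    by_contra! hne
    obtain ⟨z, hz, hzx⟩ := hne
    exact (hmin _ (h.isProperCompletelyInvariant_of_ne hf hz hzx) (fun _ hv => hv.1)
      h.left_mem).2 0 rfl
  have hfin : E.Finite := by
    refine h.isCompact.finite (isDiscrete_iff_nhdsNE.2 fun v hv => ?_)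
    obtain ⟨n, hn⟩ := hall v hv
    rw [← disjoint_iff, disjoint_principal_right]
    filter_upwards [eventually_nhdsWithin_of_eventually_nhds (h.eventually_eq hf hv hn),
      self_mem_nhdsWithin] with w hw hwv hwE
    exact hwv (hw hwE)
  have hinj : InjOn f.map E := injOn_of_ncard_image_eq (by rw [h.image_eq]) hfin
  refine subset_antisymm (fun z hz => ?_) (range_subset_iff.2 h.iterate_left_mem)
  obtain ⟨n, hn⟩ := hall z hz
  obtain ⟨i, hi⟩ := exists_iterate_iterate_eq (h.left_mem_periodicPts hf.isExpanding) n
  exact ⟨i, hinj.iterate (fun _ => h.map_mem) n (h.iterate_left_mem i) hz (hi.trans hn.symm)⟩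

end Frame

lemma IsLorenz.exists_minimal (hf : f.IsLorenz) (hover : f.map f.left < f.map f.right)
    (hE : f.IsProperCompletelyInvariant E) : ∃ X ⊆ E, f.IsProperCompletelyInvariant X ∧
      ∀ E', f.IsProperCompletelyInvariant E' → E' ⊆ X → X ⊆ E' := by
  have hsInter : ∀ C ⊆ {S | f.IsProperCompletelyInvariant S}, IsChain (· ⊆ ·) C → C.Nonempty →
      f.IsProperCompletelyInvariant (⋂₀ C) := fun C hC hchain ⟨S₀, hS₀⟩ => by
    have : Nonempty C := ⟨⟨S₀, hS₀⟩⟩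
    refine hf.isProperCompletelyInvariant hover ?_ (isClosed_sInter fun S hS => (hC hS).isClosed)
      (fun z hz => (hC hS₀).subset (hz S₀ hS₀)) (fun z hz S hS => (hC hS).map_mem (hz S hS))
      fun z hz hfz S hS => (hC hS).mem_of_map_mem hz (hfz S hS)
    exact IsCompact.nonempty_sInter_of_directed_nonempty_isCompact_isClosed
      (fun S hS T hT => (hchain.total hS hT).elim (fun hle => ⟨S, hS, subset_rfl, hle⟩)
        fun hle => ⟨T, hT, hle, subset_rfl⟩)
      (fun S hS => (hC hS).nonempty) (fun S hS => (hC hS).isCompact) fun S hS => (hC hS).isClosed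
  obtain ⟨X, hXE, hX⟩ := zorn_superset_nonempty {S | f.IsProperCompletelyInvariant S}
    (fun C hC hchain hne => ⟨⋂₀ C, hsInter C hC hchain hne, fun S hS => sInter_subset_of_mem hS⟩)
    E hE
  exact ⟨X, hXE, hX.prop, fun E' hE' hsub => hX.le_of_le hE' hsub⟩

/-- `X` is a proper completely invariant set consisting of a single periodic orbit. -/
structure IsInvariantCycle (f : LorenzData) (X : Set ℝ) : Prop extends
    f.IsProperCompletelyInvariant X where
  exists_eq_orbit : ∃ x ∈ Function.periodicPts f.map, X = range fun i : ℕ => f.map^[i] x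

lemma range_iterate_iterate (hx : x ∈ Function.periodicPts f.map) (i : ℕ) :
    (range fun j : ℕ => f.map^[j] (f.map^[i] x)) = range fun j : ℕ => f.map^[j] x := by
  refine subset_antisymm ?_ ?_
  · rintro _ ⟨j, rfl⟩
    exact ⟨j + i, Function.iterate_add_apply _ _ _ _⟩
  · rintro _ ⟨j, rfl⟩
    obtain ⟨k, hk⟩ := exists_iterate_iterate_eq hx i
    refine ⟨j + k, ?_⟩
    simp only [Function.iterate_add_apply]
    rw [(Function.Commute.iterate_iterate_self f.map k i).eq, hk]

namespace IsInvariantCycle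

variable (hX : f.IsInvariantCycle X)
include hX

lemma eq_orbit (hv : v ∈ X) : X = range fun i : ℕ => f.map^[i] v := by
  obtain ⟨x, hx, rfl⟩ := hX.exists_eq_orbit
  obtain ⟨i, rfl⟩ := hv
  exact (range_iterate_iterate hx i).symm

lemma isPeriodicPoint (hv : v ∈ X) : f.IsPeriodicPoint v := by
  refine ⟨hX.mem_Icc hv, hX.iterate_ne_crit hv, ?_⟩
  obtain ⟨x, hx, rfl⟩ := hX.exists_eq_orbit
  obtain ⟨i, rfl⟩ := hv
  exact iterate_mem_periodicPts hx i

lemma eq_or_disjoint (hE : f.IsInvariantCycle E) : E = X ∨ Disjoint E X := by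
  rw [or_iff_not_imp_right, not_disjoint_iff]
  rintro ⟨z, hzE, hzX⟩
  rw [hX.eq_orbit hzX, hE.eq_orbit hzE]

end IsInvariantCycle

lemma IsPwLinear.exists_isInvariantCycle (hf : f.IsPwLinear a b)
    (hE : f.IsProperCompletelyInvariant E) : ∃ X ⊆ E, f.IsInvariantCycle X := by
  obtain ⟨X, hXE, hX, hmin⟩ := hf.exists_minimal hf.overlap hE
  obtain ⟨_, _, x, _, h⟩ := hX.exists_frame hf.isExpanding
  exact ⟨X, hXE, hX, x, h.left_mem_periodicPts hf.isExpanding, h.eq_orbit_of_minimal hf hmin⟩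

/-! ### Uniqueness of the invariant cycle -/

namespace Frame

variable (h : f.Frame E e₀ e₁ x y)
include h

lemma exists_iterate_mem_Ioo (hf : f.IsExpanding) (hz₀ : e₀ < z) (hz₁ : z < e₁) (hz : z ∉ E) :
    ∃ n, f.map^[n] z ∈ Ioo x y := by
  obtain ⟨g, hg, hgmax⟩ := (h.isCompact.inter_right (isClosed_Iic (a := z))).exists_isGreatest
    ⟨e₀, h.least_mem, hz₀.le⟩
  obtain ⟨g', hg', hgmin⟩ := (h.isCompact.inter_right (isClosed_Ici (a := z))).exists_isLeast
    ⟨e₁, h.greatest_mem, hz₁.le⟩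
  have hgz : g < z := lt_of_le_of_ne hg.2 fun e => hz (e ▸ hg.1)
  have hgz' : z < g' := lt_of_le_of_ne hg'.2 fun e => hz (e ▸ hg'.1)
  have hgap : Disjoint E (Ioo g g') := disjoint_left.2 fun w hwE hw => (le_total w z).elim
    (fun hle => (hgmax ⟨hwE, hle⟩).not_gt hw.1) fun hle => (hgmin ⟨hwE, hle⟩).not_gt hw.2
  have hgI := h.mem_Icc hg.1
  have hgI' := h.mem_Icc hg'.1
  obtain ⟨n, hn, hcrit⟩ := hf.exists_crit_mem_Icc hgI hgI' (hgz.trans hgz')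
  have hdisj := h.disjoint_Ioo_iterate hf.toIsLorenz hgI hgI' hn hgap
  have hlt : f.map^[n] g < f.crit := hcrit.1.lt_of_ne (h.iterate_ne_crit hg.1 n)
  have hlt' : f.crit < f.map^[n] g' := hcrit.2.lt_of_ne (h.iterate_ne_crit hg'.1 n).symm
  have hzI : z ∈ Icc f.left f.right := ⟨hgI.1.trans hgz.le, hgz'.le.trans hgI'.2⟩
  have hzn := hf.sameItin_of_mem_Icc hgI hgI' hn ⟨hgz.le, hgz'.le⟩
  have hx : x ≤ f.map^[n] g := not_lt.1 fun hgx => disjoint_left.1 hdisj h.left_mem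
    ⟨hgx, h.left_lt_crit.trans hlt'⟩
  have hy : f.map^[n] g' ≤ y := not_lt.1 fun hgy => disjoint_left.1 hdisj h.right_mem
    ⟨hlt.trans h.crit_lt_right, hgy⟩
  exact ⟨n, hx.trans_lt ((hf.iterate_lt_iterate_iff hgI hzI hzn).2 hgz),
    ((hf.iterate_lt_iterate_iff hzI hgI' (hzn.symm.trans hn)).2 hgz').trans_le hy⟩

/-- If the gap of `E` contains that of `E'` then `x` visits the gap of `E'`; otherwise `y` lies in
that gap, and the return map of `E'` moves it to the left within the gap of `E`. -/
lemma left_le_left (hf : f.IsPwLinear a b) (h' : f.Frame E' e₀' e₁' x' y') (hdisj : Disjoint E E') :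
    x' ≤ x := by
  by_contra! hlt
  rcases lt_trichotomy y y' with hy | rfl | hy
  · have hyI : y ∈ Ioc f.crit y' := ⟨h.crit_lt_right, hy.le⟩
    refine disjoint_left.1 h.disjoint_Ioo
      (h.iterate_mem h.right_mem (Function.minimalPeriod f.map y'))
      ⟨hlt.trans (h'.iterate_right_mem_Ioc hf.isExpanding hyI).1, ?_⟩
    rw [h'.iterate_right_eq hf hyI, sub_lt_comm]
    exact lt_mul_of_one_lt_left (sub_pos.2 hy) (h'.one_lt_multiplier_right hf)
  · exact disjoint_left.1 hdisj h.right_mem h'.right_mem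
  · have hlow : e₀' < x := by
      rw [← h'.map_right hf.isExpanding]
      refine (hf.strictMonoOn_right ⟨h'.crit_lt_right, (h'.mem_Icc h'.right_mem).2⟩
        ⟨h.crit_lt_right, (h.mem_Icc h.right_mem).2⟩ hy).trans_le ?_
      exact (h.map_right hf.isExpanding).trans_le (h.least_le h.left_mem)
    obtain ⟨n, hn⟩ := h'.exists_iterate_mem_Ioo hf.isExpanding hlow
      (hlt.trans_le (h'.le_greatest h'.left_mem)) (disjoint_left.1 hdisj h.left_mem)
    exact disjoint_left.1 h.disjoint_Ioo (h.iterate_left_mem n) ⟨hlt.trans hn.1, hn.2.trans hy⟩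

/-- A closer periodic point would have its return interval cover `x` too early. -/
lemma minimalPeriod_left_lt (hf : f.IsExpanding) (hw : w ∈ Ioo x f.crit) (hn : n ≠ 0)
    (hper : f.map^[n] w = w) : Function.minimalPeriod f.map x < n := by
  by_contra! hle
  have hw' : w ∈ Ico x f.crit := Ioo_subset_Ico_self hw
  have hxI := h.mem_Icc h.left_mem
  have hwI := h.mem_Icc_of_mem_Ico hw' hf.toIsLorenz
  have hxw := (h.sameItin_left hf hw').mono hle
  rcases le_or_gt x (f.map^[n] x) with hge | hlt
  · exact hf.not_sameItin_of_mapsTo_Icc hxI hwI hw.1 hn hge hper.le hxw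
  · refine disjoint_left.1 (h.disjoint_Ioo_iterate hf.toIsLorenz hxI hwI hxw
      (h.disjoint_Ioo.mono_right (Ioo_subset_Ioo_right (hw.2.trans h.crit_lt_right).le)))
      h.left_mem ⟨hlt, hper.symm ▸ hw.1⟩

lemma minimalPeriod_right_lt (hf : f.IsExpanding) (hw : w ∈ Ioo f.crit y) (hn : n ≠ 0)
    (hper : f.map^[n] w = w) : Function.minimalPeriod f.map y < n := by
  rw [← reflect_minimalPeriod]
  exact h.reflect.minimalPeriod_left_lt hf.reflect (w := -w) ⟨neg_lt_neg hw.2, neg_lt_neg hw.1⟩ hn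
    (by rw [reflect_map_iterate, neg_neg, hper])

/-- The least point of the orbit is the image of a point of `(crit, y)`. -/
lemma exists_iterate_mem_Ioo_of_lt_least (hf : f.IsExpanding) (hz : f.IsPeriodicPoint z)
    (hlt : f.map^[n] z < e₀) : ∃ k, f.map^[k] z ∈ Ioo x y := by
  obtain ⟨hzI, hzc, hper⟩ := hz
  obtain ⟨_, ⟨m, rfl⟩, hmin⟩ := exists_min_image _ id (finite_range_iterate hper) ⟨z, 0, rfl⟩
  obtain ⟨_, ⟨k, rfl⟩, hk⟩ := exists_preimage_mem_orbit hper ⟨m, rfl⟩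
  have hkI : f.map^[k] z ∈ Icc f.left f.right := hf.iterate_mem_Icc hzI fun i _ => hzc i
  have hlow : f.map (f.map^[k] z) < e₀ := hk.trans_lt ((hmin _ ⟨n, rfl⟩).trans_lt hlt)
  have hcrit : f.crit < f.map^[k] z := by
    refine (hzc k).lt_of_le' (not_lt.1 fun hkc => hlow.not_ge ?_)
    exact (h.least_le_map_left hf).trans
      (hf.strictMonoOn_left.monotoneOn ⟨le_rfl, hf.left_lt⟩ ⟨hkI.1, hkc⟩ hkI.1)
  refine ⟨k, h.left_lt_crit.trans hcrit, ?_⟩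
  rwa [← hf.strictMonoOn_right.lt_iff_lt ⟨hcrit, hkI.2⟩
    ⟨h.crit_lt_right, (h.mem_Icc h.right_mem).2⟩, h.map_right hf]

end Frame

lemma IsPeriodicPoint.reflect (hz : f.IsPeriodicPoint z) : f.reflect.IsPeriodicPoint (-z) := by
  obtain ⟨hzI, hzc, hper⟩ := hz
  refine ⟨⟨neg_le_neg hzI.2, neg_le_neg hzI.1⟩, fun i hi => hzc i ?_, ?_⟩
  · rwa [reflect_map_iterate, neg_neg, LorenzData.reflect, neg_inj] at hi
  · rwa [← Function.minimalPeriod_pos_iff_mem_periodicPts, reflect_minimalPeriod,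
      Function.minimalPeriod_pos_iff_mem_periodicPts]

lemma Frame.minimalPeriod_lt (h : f.Frame E e₀ e₁ x y) (hf : f.IsExpanding)
    (hz : f.IsPeriodicPoint z) (hdisj : ∀ n, f.map^[n] z ∉ E) :
    Function.minimalPeriod f.map x < Function.minimalPeriod f.map z ∨
      Function.minimalPeriod f.map y < Function.minimalPeriod f.map z := by
  obtain ⟨k, hk⟩ : ∃ k, f.map^[k] z ∈ Ioo x y := by
    rcases lt_trichotomy z e₀ with hlt | rfl | hgt
    · exact h.exists_iterate_mem_Ioo_of_lt_least hf hz (n := 0) hlt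
    · exact absurd h.least_mem (hdisj 0)
    rcases lt_trichotomy z e₁ with hlt | rfl | hgt'
    · exact h.exists_iterate_mem_Ioo hf hgt hlt (hdisj 0)
    · exact absurd h.greatest_mem (hdisj 0)
    · obtain ⟨k, hk⟩ := h.reflect.exists_iterate_mem_Ioo_of_lt_least hf.reflect hz.reflect
        (n := 0) (neg_lt_neg hgt')
      rw [reflect_map_iterate, neg_neg] at hk
      exact ⟨k, neg_lt_neg_iff.1 hk.2, neg_lt_neg_iff.1 hk.1⟩
  have hper := (Function.isPeriodicPt_minimalPeriod f.map z).apply_iterate k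
  have hpos := (Function.minimalPeriod_pos_of_mem_periodicPts hz.2.2).ne'
  rcases lt_or_gt_of_ne (hz.2.1 k) with hkc | hkc
  · exact Or.inl (h.minimalPeriod_left_lt hf ⟨hk.1, hkc⟩ hpos hper)
  · exact Or.inr (h.minimalPeriod_right_lt hf ⟨hkc, hk.2⟩ hpos hper)

namespace IsInvariantCycle

variable (hX : f.IsInvariantCycle X)
include hX

lemma unique (hf : f.IsPwLinear a b) (hE : f.IsInvariantCycle E) : E = X := by
  refine (hX.eq_or_disjoint hE).resolve_right fun hdisj => ?_
  obtain ⟨_, _, x, _, hx⟩ := hX.exists_frame hf.isExpanding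
  obtain ⟨_, _, x', _, hx'⟩ := hE.exists_frame hf.isExpanding
  have heq : x = x' := (hx'.left_le_left hf hx hdisj).antisymm (hx.left_le_left hf hx' hdisj.symm)
  exact disjoint_left.1 hdisj hx'.left_mem (heq ▸ hx.left_mem)

lemma subset_of_isProperCompletelyInvariant (hf : f.IsPwLinear a b)
    (hE : f.IsProperCompletelyInvariant E) : X ⊆ E := by
  obtain ⟨X', hsub, hX'⟩ := hf.exists_isInvariantCycle hE
  exact hX.unique hf hX' ▸ hsub

theorem isMinimalCompletelyInvariant (hf : f.IsPwLinear a b) :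
    f.IsMinimalCompletelyInvariant X := by
  refine ⟨Or.inr hX.toIsProperCompletelyInvariant, ?_⟩
  rintro E (rfl | hE)
  · exact fun z hz => hX.mem_Icc hz
  · exact hX.subset_of_isProperCompletelyInvariant hf hE

theorem eq_of_isMinPeriodOrbit (hf : f.IsExpanding) (hO : f.IsMinPeriodOrbit O) : O = X := by
  obtain ⟨z, hz, rfl, hmin⟩ := hO
  obtain ⟨_, _, x, y, h⟩ := hX.exists_frame hf
  by_cases hmeet : ∃ i, f.map^[i] z ∈ X
  · obtain ⟨i, hi⟩ := hmeet
    rw [hX.eq_orbit hi, range_iterate_iterate hz.2.2]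
  · rcases h.minimalPeriod_lt hf hz (not_exists.1 hmeet) with hlt | hlt
    · exact absurd (hmin x (hX.isPeriodicPoint h.left_mem)) hlt.not_ge
    · exact absurd (hmin y (hX.isPeriodicPoint h.right_mem)) hlt.not_ge

end IsInvariantCycle

end InvariantCycles

/-! ### Preimages of a periodic orbit -/

section Preimages

open scoped Pointwise

variable {f : LorenzData} {E O P : Set ℝ} {n : ℕ} {z : ℝ}

namespace IsLorenz

variable (hf : f.IsLorenz)
include hf

lemma nhds_iterate_le_map (hz : z ∈ Ioo f.left f.right) (hc : ∀ i < n, f.map^[i] z ≠ f.crit) :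
    𝓝 (f.map^[n] z) ≤ Filter.map f.map^[n] (𝓝 z) := by
  intro S hS
  obtain ⟨l, u, hzlu, hlu⟩ := mem_nhds_iff_exists_Ioo_subset.1 (inter_mem (mem_map.1 hS)
    (inter_mem (Ioo_mem_nhds hz.1 hz.2) (hf.eventually_sameItin hz hc)))
  obtain ⟨p, hlp, hpz⟩ := exists_between hzlu.1
  obtain ⟨q, hzq, hqu⟩ := exists_between hzlu.2
  obtain ⟨-, hp, hzp⟩ := hlu ⟨hlp, hpz.trans hzlu.2⟩
  obtain ⟨-, hq, hzq'⟩ := hlu ⟨hzlu.1.trans hzq, hqu⟩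
  have hzI := Ioo_subset_Icc_self hz
  have hpI := Ioo_subset_Icc_self hp
  have hqI := Ioo_subset_Icc_self hq
  have hpq : f.SameItin n p q := hzp.symm.trans hzq'
  filter_upwards [Icc_mem_nhds ((hf.iterate_lt_iterate_iff hpI hzI hzp.symm).2 hpz)
    ((hf.iterate_lt_iterate_iff hzI hqI hzq').2 hzq)] with t ht
  obtain ⟨v, hv, rfl⟩ := hf.exists_iterate_eq hpI hqI hpq (hpz.trans hzq).le ht
  exact (hlu ⟨hlp.trans_le hv.1, hv.2.trans_lt hqu⟩).1

section BackwardInvariant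

variable (hpre : ∀ z ∈ Ioo f.left f.right \ {f.crit}, f.map z ∈ P → z ∈ P)
include hpre

lemma mem_closure_of_iterate_mem_closure (hz : z ∈ Ioo f.left f.right)
    (hc : ∀ i < n, f.map^[i] z ≠ f.crit) (h : f.map^[n] z ∈ closure P) : z ∈ closure P := by
  rw [mem_closure_iff_frequently] at h ⊢
  have hfreq : ∃ᶠ w in 𝓝 z, f.map^[n] w ∈ P := h.filter_mono (hf.nhds_iterate_le_map hz hc)
  refine (hfreq.and_eventually ((hf.eventually_sameItin hz hc).and
    (Ioo_mem_nhds hz.1 hz.2))).mono fun w ⟨hw, hzw, hwI⟩ => ?_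
  exact hf.mem_of_iterate_mem hpre hwI hzw.symm.ne_crit hw

lemma left_notMem_closure (hsub : P ⊆ Ioo f.left f.right) (hc : f.crit ∉ closure P) :
    f.left ∉ closure P := by
  have hPc : ∀ᶠ v in 𝓝[>] f.crit, v ∉ P :=
    (not_frequently.1 (mt mem_closure_iff_frequently.2 hc)).filter_mono nhdsWithin_le_nhds
  obtain ⟨w, hcw, hw⟩ := (mem_nhdsGT_iff_exists_mem_Ioc_Ioo_subset hf.lt_right).1 hPc
  rw [mem_closure_iff_frequently, not_frequently]
  filter_upwards [gt_mem_nhds (hf.left_lt_map hcw)] with t ht htP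
  have hmono := hf.strictMonoOn_right.monotoneOn hcw (right_mem_Ioc.2 hf.lt_right) hcw.2
  obtain ⟨u, hu, rfl⟩ := hf.exists_right_preimage ⟨(hsub htP).1, ht.le.trans hmono⟩
  have huw : u < w := (hf.strictMonoOn_right.lt_iff_lt hu hcw).1 ht
  exact hw ⟨hu.1, huw⟩
    (hpre u ⟨⟨hf.left_lt.trans hu.1, huw.trans_le hcw.2⟩, hu.1.ne'⟩ htP)

lemma right_notMem_closure (hsub : P ⊆ Ioo f.left f.right) (hc : f.crit ∉ closure P) :
    f.right ∉ closure P := by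
  have hleft : f.reflect.left ∉ closure (-P) := by
    refine hf.reflect.left_notMem_closure (fun z hz hfz => ?_) (fun z hz => ?_) ?_
    · exact hpre (-z) ⟨⟨lt_neg.2 hz.1.2, neg_lt.2 hz.1.1⟩, fun e => hz.2 (neg_eq_iff_eq_neg.1 e)⟩
        (Set.neg_mem_neg.1 hfz)
    · exact ⟨neg_lt.1 (hsub hz).2, lt_neg.1 (hsub hz).1⟩
    · rwa [← neg_closure, LorenzData.reflect, Set.neg_mem_neg]
  rwa [← neg_closure, LorenzData.reflect, Set.neg_mem_neg] at hleft

theorem isProperCompletelyInvariant_closure (hover : f.map f.left < f.map f.right)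
    (hne : P.Nonempty) (hsub : P ⊆ Ioo f.left f.right) (hmap : ∀ z ∈ P, f.map z ∈ P)
    (hc : f.crit ∉ closure P) : f.IsProperCompletelyInvariant (closure P) := by
  have hIcc : closure P ⊆ Icc f.left f.right :=
    closure_minimal (hsub.trans Ioo_subset_Icc_self) isClosed_Icc
  have hsub' : closure P ⊆ Ioo f.left f.right \ {f.crit} := fun z hz =>
    ⟨⟨(hIcc hz).1.lt_of_ne (ne_of_mem_of_not_mem hz
        (hf.left_notMem_closure hpre hsub hc)).symm,
      (hIcc hz).2.lt_of_ne (ne_of_mem_of_not_mem hz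
        (hf.right_notMem_closure hpre hsub hc))⟩, ne_of_mem_of_not_mem hz hc⟩
  refine hf.isProperCompletelyInvariant hover hne.closure isClosed_closure hsub' (fun z hz => ?_)
    fun z hz hfz => ?_
  · exact closure_mono (image_subset_iff.2 hmap) (mem_closure_image
      (hf.continuousAt_map (hsub' hz).1 (hsub' hz).2) hz)
  · refine hf.mem_closure_of_iterate_mem_closure hpre hz.1 (n := 1) (fun i hi => ?_) hfz
    rw [Nat.lt_one_iff.1 hi]
    exact hz.2

end BackwardInvariant

end IsLorenz

/-- Every interval contains a preimage of `crit`. -/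
theorem IsExpanding.closure_eq_Icc (hf : f.IsExpanding)
    (hpre : ∀ z ∈ Ioo f.left f.right \ {f.crit}, f.map z ∈ P → z ∈ P)
    (hsub : P ⊆ Ioo f.left f.right) (hc : f.crit ∈ closure P) :
    closure P = Icc f.left f.right := by
  refine (closure_minimal (hsub.trans Ioo_subset_Icc_self) isClosed_Icc).antisymm ?_
  rw [← closure_Ioo hf.left_lt_right.ne]
  refine closure_minimal (fun w hw => ?_) isClosed_closure
  by_contra hwP
  obtain ⟨w', hww', hgap⟩ := mem_nhdsGE_iff_exists_Icc_subset.1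
    (mem_nhdsWithin_of_mem_nhds (inter_mem (isClosed_closure.isOpen_compl.mem_nhds hwP)
      (Ioo_mem_nhds hw.1 hw.2)) : (closure P)ᶜ ∩ Ioo f.left f.right ∈ 𝓝[≥] w)
  have hwI := Ioo_subset_Icc_self hw
  have hwI' := Ioo_subset_Icc_self (hgap (right_mem_Icc.2 hww'.le)).2
  obtain ⟨n, hn, hcrit⟩ := hf.exists_crit_mem_Icc hwI hwI' hww'
  obtain ⟨u, hu, hfu⟩ := hf.exists_iterate_eq hwI hwI' hn hww'.le hcrit
  exact (hgap hu).1 (hf.mem_closure_of_iterate_mem_closure hpre (hgap hu).2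
    (hf.sameItin_of_mem_Icc hwI hwI' hn hu).symm.ne_crit (hfu ▸ hc))

/-- The union of the iterated preimages of `O` in the open interval; its closure is
`preimageClosure`. -/
def preimages (f : LorenzData) (O : Set ℝ) : Set ℝ :=
  {x | x ∈ Ioo f.left f.right ∧ ∃ n : ℕ, (∀ i < n, f.map^[i] x ≠ f.crit) ∧ f.map^[n] x ∈ O}

lemma mem_preimages_of_map_mem (hz : z ∈ Ioo f.left f.right \ {f.crit})
    (h : f.map z ∈ f.preimages O) : z ∈ f.preimages O := by
  obtain ⟨-, n, hc, hn⟩ := h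
  refine ⟨hz.1, n + 1, fun i hi => ?_, hn⟩
  cases i with
  | zero => exact hz.2
  | succ i => exact hc i (Nat.lt_of_succ_lt_succ hi)

lemma map_mem_preimages (hf : f.IsLorenz) (hO : ∀ z ∈ O, f.map z ∈ O) (hc : f.crit ∉ f.preimages O)
    (hz : z ∈ f.preimages O) : f.map z ∈ f.preimages O := by
  have hzc : z ≠ f.crit := ne_of_mem_of_not_mem hz hc
  obtain ⟨hzI, n, hn, hnO⟩ := hz
  refine ⟨hf.map_mem_Ioo hzI hzc, ?_⟩
  cases n with
  | zero => exact ⟨0, fun i hi => absurd hi i.not_lt_zero, hO z hnO⟩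
  | succ n => exact ⟨n, fun i hi => hn (i + 1) (Nat.succ_lt_succ hi), hnO⟩

lemma IsProperCompletelyInvariant.preimageClosure_eq (hE : f.IsProperCompletelyInvariant E)
    (hf : f.IsLorenz) : f.preimageClosure E = E := by
  have hpreimages : f.preimages E = E := by
    refine subset_antisymm ?_ fun z hz =>
      ⟨hE.mem_Ioo hz, 0, fun i hi => absurd hi i.not_lt_zero, hz⟩
    rintro z ⟨hz, n, hc, hn⟩
    exact hf.mem_of_iterate_mem (fun _ => hE.mem_of_map_mem) hz hc hn
  rw [preimageClosure, ← preimages, hpreimages, hE.isClosed.closure_eq]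

theorem IsExpanding.preimageClosure_eq_Icc (hf : f.IsExpanding)
    (hover : f.map f.left < f.map f.right) (hno : ∀ E, ¬ f.IsProperCompletelyInvariant E)
    (hO : ∀ z ∈ O, f.map z ∈ O) (hne : (O ∩ Ioo f.left f.right).Nonempty) :
    f.preimageClosure O = Icc f.left f.right := by
  have hpre : ∀ z ∈ Ioo f.left f.right \ {f.crit}, f.map z ∈ f.preimages O → z ∈ f.preimages O :=
    fun _ => mem_preimages_of_map_mem
  have hsub : f.preimages O ⊆ Ioo f.left f.right := fun _ hz => hz.1
  refine hf.closure_eq_Icc hpre hsub ?_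
  by_contra hc
  obtain ⟨z, hzO, hz⟩ := hne
  exact hno _ (hf.isProperCompletelyInvariant_closure hpre hover
    ⟨z, hz, 0, fun i hi => absurd hi i.not_lt_zero, hzO⟩ hsub
    (fun _ => map_mem_preimages hf.toIsLorenz hO (mt (fun h => subset_closure h) hc)) hc)

lemma IsLorenz.mem_Ioo_or_map_mem_Ioo (hf : f.IsLorenz) (hz : z ∈ Icc f.left f.right)
    (h : f.map z ≠ z) : z ∈ Ioo f.left f.right ∨ f.map z ∈ Ioo f.left f.right := by
  rcases eq_endpoints_or_mem_Ioo_of_mem_Icc hz with rfl | rfl | hzI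
  · exact Or.inr ⟨hf.left_le_map_left.lt_of_ne' h, hf.map_lt_right (left_mem_Ico.2 hf.left_lt)⟩
  · exact Or.inr ⟨hf.left_lt_map (right_mem_Ioc.2 hf.lt_right), hf.map_right_le_right.lt_of_ne h⟩
  · exact Or.inl hzI

lemma IsLorenz.nonempty_inter_Ioo_of_nontrivial_orbit (hf : f.IsLorenz)
    (hz : z ∈ Icc f.left f.right) (hO : (range fun i : ℕ => f.map^[i] z).Nontrivial) :
    ((range fun i : ℕ => f.map^[i] z) ∩ Ioo f.left f.right).Nonempty := by
  have hmoves : f.map z ≠ z := fun hfix => by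
    obtain ⟨_, ⟨i, rfl⟩, _, ⟨j, rfl⟩, hij⟩ := hO
    exact hij (by simp only [Function.iterate_fixed hfix])
  rcases hf.mem_Ioo_or_map_mem_Ioo hz hmoves with hmem | hmem
  · exact ⟨z, ⟨0, rfl⟩, hmem⟩
  · exact ⟨f.map z, ⟨1, rfl⟩, hmem⟩

end Preimages

/-! ### The return map to a gap around the critical point -/

section Renormalization

variable {f g g' : LorenzData} {a b s : ℝ} {E E' O S T X : Set ℝ} {e₀ e₁ u u' v v' x y z : ℝ}
  {k n ℓ ℓ' r r' : ℕ}

lemma IterContOn.mono (h : f.IterContOn n T) (hST : S ⊆ T) : f.IterContOn n S :=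
  ⟨fun z hz => h.1 z (hST hz), h.2.mono hST⟩

lemma isPwLinear_of_map_eq (hl : f.left < f.crit) (hr : f.crit < f.right) (ha : 0 < a) (hb : 0 < b)
    (hlt : ∀ x ∈ Ico f.left f.crit, f.map x = f.right - a * (f.crit - x))
    (hgt : ∀ x ∈ Ioc f.crit f.right, f.map x = f.left + b * (x - f.crit))
    (hleft : f.left ≤ f.map f.left) (hright : f.map f.right ≤ f.right)
    (hover : f.map f.left < f.map f.right) : f.IsPwLinear a b := by
  have hA : StrictMono fun x => f.right - a * (f.crit - x) := fun z w hzw => by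
    simpa only [sub_lt_sub_iff_left, mul_lt_mul_iff_right₀ ha] using hzw
  have hB : StrictMono fun x => f.left + b * (x - f.crit) := fun z w hzw => by
    simpa only [add_lt_add_iff_left, mul_lt_mul_iff_right₀ hb, sub_lt_sub_iff_right] using hzw
  have hAc : Continuous fun x => f.right - a * (f.crit - x) := by fun_prop
  have hBc : Continuous fun x => f.left + b * (x - f.crit) := by fun_prop
  refine
    { left_lt := hl
      lt_right := hr
      continuousOn_left := hAc.continuousOn.congr hlt
      continuousOn_right := hBc.continuousOn.congr hgt
      strictMonoOn_left := (hA.strictMonoOn _).congr fun x hx => (hlt x hx).symm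
      strictMonoOn_right := (hB.strictMonoOn _).congr fun x hx => (hgt x hx).symm
      mapsTo := fun z hz => ?_
      tendsto_left := ?_
      tendsto_right := ?_
      map_of_lt := hlt
      map_of_gt := hgt
      overlap := hover }
  · rw [hlt _ (left_mem_Ico.2 hl)] at hleft
    rw [hgt _ (right_mem_Ioc.2 hr)] at hright
    rcases lt_or_gt_of_ne hz.2 with hzc | hzc
    · rw [hlt z ⟨hz.1.1, hzc⟩]
      exact ⟨hleft.trans (hA.monotone hz.1.1), sub_le_self _ (mul_pos ha (sub_pos.2 hzc)).le⟩
    · rw [hgt z ⟨hzc, hz.1.2⟩]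
      exact ⟨le_add_of_nonneg_right (mul_pos hb (sub_pos.2 hzc)).le,
        (hB.monotone hz.1.2).trans hright⟩
  · refine Tendsto.congr' (eventually_of_mem (Ioo_mem_nhdsLT hl)
      fun x hx => (hlt x (Ioo_subset_Ico_self hx)).symm) ?_
    simpa only [sub_self, mul_zero, sub_zero] using
      (hAc.tendsto f.crit).mono_left nhdsWithin_le_nhds
  · refine Tendsto.congr' (eventually_of_mem (Ioo_mem_nhdsGT hr)
      fun x hx => (hgt x (Ioo_subset_Ioc_self hx)).symm) ?_
    simpa only [sub_self, mul_zero, add_zero] using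
      (hBc.tendsto f.crit).mono_left nhdsWithin_le_nhds

/-- The return map to a gap `(x, y)` around `crit` between two periodic points, on the interval
spanned by its one-sided values at `crit`; this is the renormalization associated with a completely
invariant set having that gap. -/
noncomputable def gapReturn (f : LorenzData) (a b x y : ℝ) : LorenzData :=
  f.glue (Function.minimalPeriod f.map x) (Function.minimalPeriod f.map y)
    (y - f.multiplier a b y * (y - f.crit)) (x + f.multiplier a b x * (f.crit - x))

namespace Frame

variable (h : f.Frame E e₀ e₁ x y)
include h

lemma one_lt_minimalPeriod_left (hf : f.IsExpanding) : 1 < Function.minimalPeriod f.map x := by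
  have hpos := Function.minimalPeriod_pos_of_mem_periodicPts (h.left_mem_periodicPts hf)
  refine Nat.one_lt_iff_ne_zero_and_ne_one.2 ⟨hpos.ne', fun hone => ?_⟩
  have hfix := (Function.minimalPeriod_eq_one_iff_isFixedPt.1 hone).symm.trans (h.map_left hf)
  exact ((h.left_lt_crit.trans h.crit_lt_right).trans_le (h.le_greatest h.right_mem)).ne hfix

lemma one_lt_minimalPeriod_right (hf : f.IsExpanding) : 1 < Function.minimalPeriod f.map y := by
  rw [← reflect_minimalPeriod]
  exact h.reflect.one_lt_minimalPeriod_left hf.reflect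

variable (hf : f.IsPwLinear a b)
include hf

lemma iterContOn_left : f.IterContOn (Function.minimalPeriod f.map x) (Ico x f.crit) :=
  ⟨fun _ hz => (h.sameItin_left hf.isExpanding hz).symm.ne_crit,
    ContinuousOn.congr (f := fun z => x + f.multiplier a b x * (z - x)) (by fun_prop)
      fun _ hz => h.iterate_left_eq hf hz⟩

lemma iterContOn_right : f.IterContOn (Function.minimalPeriod f.map y) (Ioc f.crit y) :=
  ⟨fun _ hz => (h.sameItin_right hf.isExpanding hz).symm.ne_crit,
    ContinuousOn.congr (f := fun z => y - f.multiplier a b y * (y - z)) (by fun_prop)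
      fun _ hz => h.iterate_right_eq hf hz⟩

lemma isGreatest_left :
    IsGreatest {n : ℕ | f.IterContOn n (Ioo x f.crit)} (Function.minimalPeriod f.map x) := by
  refine ⟨(h.iterContOn_left hf).mono Ioo_subset_Ico_self, fun n hn => ?_⟩
  by_contra! hlt
  have hA := h.one_lt_multiplier_left hf
  have hgap := sub_pos.2 h.left_lt_crit
  have hz : x + (f.crit - x) / f.multiplier a b x ∈ Ioo x f.crit :=
    ⟨lt_add_of_pos_right _ (div_pos hgap (one_pos.trans hA)),
      lt_sub_iff_add_lt'.1 (div_lt_self hgap hA)⟩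
  refine hn.1 _ hz _ hlt ?_
  rw [h.iterate_left_eq hf (Ioo_subset_Ico_self hz), add_sub_cancel_left,
    mul_div_cancel₀ _ (one_pos.trans hA).ne', add_sub_cancel]

lemma isGreatest_right :
    IsGreatest {n : ℕ | f.IterContOn n (Ioo f.crit y)} (Function.minimalPeriod f.map y) := by
  refine ⟨(h.iterContOn_right hf).mono Ioo_subset_Ioc_self, fun n hn => ?_⟩
  by_contra! hlt
  have hB := h.one_lt_multiplier_right hf
  have hgap := sub_pos.2 h.crit_lt_right
  have hz : y - (y - f.crit) / f.multiplier a b y ∈ Ioo f.crit y :=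
    ⟨lt_sub_comm.1 (div_lt_self hgap hB), sub_lt_self _ (div_pos hgap (one_pos.trans hB))⟩
  refine hn.1 _ hz _ hlt ?_
  rw [h.iterate_right_eq hf (Ioo_subset_Ioc_self hz), sub_sub_cancel,
    mul_div_cancel₀ _ (one_pos.trans hB).ne', sub_sub_cancel]

lemma left_le_gapReturn_left : x ≤ (f.gapReturn a b x y).left :=
  le_sub_comm.1 (h.multiplier_right_mul_le hf)

lemma gapReturn_right_le_right : (f.gapReturn a b x y).right ≤ y :=
  le_sub_iff_add_le'.1 (h.multiplier_left_mul_le hf)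

theorem isPwLinear_gapReturn :
    (f.gapReturn a b x y).IsPwLinear (f.multiplier a b x) (f.multiplier a b y) := by
  have hA := h.one_lt_multiplier_left hf
  have hB := h.one_lt_multiplier_right hf
  have hxu := h.left_le_gapReturn_left hf
  have hvy := h.gapReturn_right_le_right hf
  have hlt : ∀ z ∈ Ico (f.gapReturn a b x y).left f.crit, (f.gapReturn a b x y).map z =
      (f.gapReturn a b x y).right - f.multiplier a b x * (f.crit - z) := fun z hz => by
    simp only [gapReturn, glue, if_pos hz.2, h.iterate_left_eq hf ⟨hxu.trans hz.1, hz.2⟩]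
    ring
  have hgt : ∀ z ∈ Ioc f.crit (f.gapReturn a b x y).right, (f.gapReturn a b x y).map z =
      (f.gapReturn a b x y).left + f.multiplier a b y * (z - f.crit) := fun z hz => by
    simp only [gapReturn, glue, if_neg hz.1.le.not_gt,
      h.iterate_right_eq hf ⟨hz.1, hz.2.trans hvy⟩]
    ring
  have huc : (f.gapReturn a b x y).left < f.crit :=
    sub_lt_comm.1 (lt_mul_of_one_lt_left (sub_pos.2 h.crit_lt_right) hB)
  have hcv : f.crit < (f.gapReturn a b x y).right :=
    sub_lt_iff_lt_add'.1 (lt_mul_of_one_lt_left (sub_pos.2 h.left_lt_crit) hA)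
  have hleft := hlt _ (left_mem_Ico.2 huc)
  have hright := hgt _ (right_mem_Ioc.2 hcv)
  have hu : (f.gapReturn a b x y).left = y - f.multiplier a b y * (y - f.crit) := rfl
  have hv : (f.gapReturn a b x y).right = x + f.multiplier a b x * (f.crit - x) := rfl
  refine isPwLinear_of_map_eq huc hcv (one_pos.trans hA) (one_pos.trans hB) hlt hgt ?_ ?_ ?_
  · rw [hleft]
    nlinarith
  · rw [hright]
    nlinarith
  · rw [hleft, hright]
    have hcu := lt_mul_of_one_lt_left (sub_pos.2 huc) hA
    have hvc := lt_mul_of_one_lt_left (sub_pos.2 hcv) hB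
    linarith

lemma hasReturnTimes :
    f.HasReturnTimes E (Function.minimalPeriod f.map x) (Function.minimalPeriod f.map y) :=
  ⟨x, y, h.left.isLUB, h.right.isGLB, h.isGreatest_left hf, h.isGreatest_right hf⟩

theorem isRenormalization_gapReturn :
    f.IsRenormalization (Function.minimalPeriod f.map x) (Function.minimalPeriod f.map y)
      (f.gapReturn a b x y) := by
  have hxI := h.mem_Ioo h.left_mem
  have hyI := h.mem_Ioo h.right_mem
  have hu := h.left_le_gapReturn_left hf
  have hv := h.gapReturn_right_le_right hf
  exact ⟨h.one_lt_minimalPeriod_left hf.isExpanding, h.one_lt_minimalPeriod_right hf.isExpanding,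
    _, _, hxI.1.le.trans hu, hv.trans hyI.2.le, Or.inl (hxI.1.trans_le hu).ne',
    (h.iterContOn_left hf).mono (Ico_subset_Ico_left hu),
    (h.iterContOn_right hf).mono (Ioc_subset_Ioc_right hv), rfl,
    (h.isPwLinear_gapReturn hf).toIsLorenz, E, h.toIsProperCompletelyInvariant,
    h.hasReturnTimes hf⟩

end Frame

/-! ### The renormalization process -/

lemma HasReturnTimes.le (h : f.HasReturnTimes E ℓ r) (h' : f.HasReturnTimes E' ℓ' r')
    (hE : E ⊆ E') : ℓ ≤ ℓ' ∧ r ≤ r' := by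
  obtain ⟨p, q, hp, hq, hℓ, hr⟩ := h
  obtain ⟨p', q', hp', hq', hℓ', hr'⟩ := h'
  have hpp' : p ≤ p' := hp.mono hp' (inter_subset_inter_left _ hE)
  have hqq' : q' ≤ q := hq.mono hq' (inter_subset_inter_left _ hE)
  exact ⟨hℓ'.2 (IterContOn.mono hℓ.1 (Ioo_subset_Ioo_left hpp')),
    hr'.2 (IterContOn.mono hr.1 (Ioo_subset_Ioo_right hqq'))⟩

lemma HasReturnTimes.unique (h : f.HasReturnTimes E ℓ r) (h' : f.HasReturnTimes E ℓ' r') :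
    ℓ = ℓ' ∧ r = r' := by
  have hle := h.le h' Subset.rfl
  have hle' := h'.le h Subset.rfl
  exact ⟨hle.1.antisymm hle'.1, hle.2.antisymm hle'.2⟩

/-- The ends of the interval are the one-sided limits of the map at the critical point. -/
lemma glue_eq_of_isLorenz (h : (f.glue ℓ r u v).IsLorenz) (h' : (f.glue ℓ r u' v').IsLorenz) :
    f.glue ℓ r u v = f.glue ℓ r u' v' := by
  obtain rfl : v = v' := tendsto_nhds_unique h.tendsto_left h'.tendsto_left
  obtain rfl : u = u' := tendsto_nhds_unique h.tendsto_right h'.tendsto_right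
  rfl

lemma IsRenormalization.eq (h : f.IsRenormalization ℓ r g) (h' : f.IsRenormalization ℓ r g') :
    g = g' := by
  obtain ⟨-, -, _, _, -, -, -, -, -, rfl, hg, -⟩ := h
  obtain ⟨-, -, _, _, -, -, -, -, -, rfl, hg', -⟩ := h'
  exact glue_eq_of_isLorenz hg hg'

lemma IsMinimalRenormalization.unique (h : f.IsMinimalRenormalization g)
    (h' : f.IsMinimalRenormalization g') : g = g' := by
  obtain ⟨ℓ, r, hg, hmin⟩ := h
  obtain ⟨ℓ', r', hg', hmin'⟩ := h'
  obtain rfl : ℓ = ℓ' := (hmin _ _ _ hg').1.antisymm (hmin' _ _ _ hg).1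
  obtain rfl : r = r' := (hmin _ _ _ hg').2.antisymm (hmin' _ _ _ hg).2
  exact hg.eq hg'

lemma IsRenormalization.exists_isProperCompletelyInvariant (h : f.IsRenormalization ℓ r g) :
    ∃ E, f.IsProperCompletelyInvariant E ∧ f.HasReturnTimes E ℓ r := by
  obtain ⟨-, -, _, _, -, -, -, -, -, -, -, hE⟩ := h
  exact hE

theorem IsRenormalization.exists_eq_gapReturn (hf : f.IsPwLinear a b)
    (h : f.IsRenormalization ℓ r g) : ∃ E e₀ e₁ x y, f.Frame E e₀ e₁ x y ∧
      g = f.gapReturn a b x y ∧ ℓ = Function.minimalPeriod f.map x ∧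
      r = Function.minimalPeriod f.map y := by
  obtain ⟨E, hE, htimes⟩ := h.exists_isProperCompletelyInvariant
  obtain ⟨e₀, e₁, x, y, hframe⟩ := hE.exists_frame hf.isExpanding
  obtain ⟨rfl, rfl⟩ := htimes.unique (hframe.hasReturnTimes hf)
  exact ⟨E, e₀, e₁, x, y, hframe, h.eq (hframe.isRenormalization_gapReturn hf), rfl, rfl⟩

theorem IsInvariantCycle.exists_isMinimalRenormalization (hX : f.IsInvariantCycle X)
    (hf : f.IsPwLinear a b) : ∃ g, f.IsMinimalRenormalization g := by
  obtain ⟨_, _, _, _, h⟩ := hX.exists_frame hf.isExpanding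
  refine ⟨_, _, _, h.isRenormalization_gapReturn hf, fun ℓ' r' g' hg' => ?_⟩
  obtain ⟨E, hE, htimes⟩ := hg'.exists_isProperCompletelyInvariant
  exact (h.hasReturnTimes hf).le htimes (hX.subset_of_isProperCompletelyInvariant hf hE)

lemma IsPwLinear.exists_isMinimalRenormalization (hf : f.IsPwLinear a b)
    (hg : f.IsRenormalization ℓ r g) : ∃ g, f.IsMinimalRenormalization g := by
  obtain ⟨E, hE, -⟩ := hg.exists_isProperCompletelyInvariant
  obtain ⟨X, -, hX⟩ := hf.exists_isInvariantCycle hE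
  exact hX.exists_isMinimalRenormalization hf

lemma IsPwLinear.exists_isPwLinear_of_isRenormalization (hf : f.IsPwLinear a b)
    (hg : f.IsRenormalization ℓ r g) : ∃ a' b', g.IsPwLinear a' b' ∧ 1 < a' ∧ 1 < b' ∧
      ∀ s, 1 ≤ s → s ≤ a → s ≤ b → s ^ 2 ≤ a' ∧ s ^ 2 ≤ b' := by
  obtain ⟨E, _, _, x, y, h, rfl, rfl, rfl⟩ := hg.exists_eq_gapReturn hf
  refine ⟨_, _, h.isPwLinear_gapReturn hf, h.one_lt_multiplier_left hf,
    h.one_lt_multiplier_right hf, fun s hs ha hb => ?_⟩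
  have hs₀ := zero_le_one.trans hs
  exact ⟨(pow_le_pow_right₀ hs hg.1).trans (pow_le_iterSlope hs₀ ha hb _ _),
    (pow_le_pow_right₀ hs hg.2.1).trans (pow_le_iterSlope hs₀ ha hb _ _)⟩

lemma IsPwLinear.slope_le_two (hf : f.IsPwLinear a b) (ha : s ≤ a) (hb : s ≤ b) : s ≤ 2 := by
  have hleft := hf.left_le_map_left
  have hright := hf.map_right_le_right
  rw [hf.map_left] at hleft
  rw [hf.map_right] at hright
  have hac := mul_le_mul_of_nonneg_right ha (sub_pos.2 hf.left_lt).le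
  have hbc := mul_le_mul_of_nonneg_right hb (sub_pos.2 hf.lt_right).le
  refine le_of_mul_le_mul_right ?_ (sub_pos.2 hf.left_lt_right)
  linarith

namespace IsRenormalizationChain

variable {F : ℕ → LorenzData}

lemma isPwLinear (hF : f.IsRenormalizationChain k F) (hf : f.IsPwLinear a b) :
    ∀ i ≤ k, ∃ a' b', (F i).IsPwLinear a' b'
  | 0, _ => ⟨a, b, hF.1 ▸ hf⟩
  | i + 1, hi => by
    obtain ⟨a', b', h⟩ := hF.isPwLinear hf i (Nat.le_of_succ_le hi)
    obtain ⟨ℓ, r, hg, -⟩ := hF.2 i hi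
    obtain ⟨a'', b'', h', -⟩ := h.exists_isPwLinear_of_isRenormalization hg
    exact ⟨a'', b'', h'⟩

lemma pow_le_slope (hF : f.IsRenormalizationChain k F) (hf : f.IsPwLinear a b) (hs : 1 ≤ s)
    (ha : s ≤ a) (hb : s ≤ b) :
    ∀ i ≤ k, ∃ a' b', (F i).IsPwLinear a' b' ∧ s ^ (i + 1) ≤ a' ∧ s ^ (i + 1) ≤ b'
  | 0, _ => ⟨a, b, hF.1 ▸ hf, by rwa [zero_add, pow_one], by rwa [zero_add, pow_one]⟩
  | i + 1, hi => by
    obtain ⟨a', b', h, ha', hb'⟩ := hF.pow_le_slope hf hs ha hb i (Nat.le_of_succ_le hi)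
    obtain ⟨ℓ, r, hg, -⟩ := hF.2 i hi
    obtain ⟨a'', b'', h', -, -, hsq⟩ := h.exists_isPwLinear_of_isRenormalization hg
    have hpow : s ^ (i + 1 + 1) ≤ (s ^ (i + 1)) ^ 2 := by
      rw [← pow_mul]
      exact pow_le_pow_right₀ hs (by lia)
    exact ⟨a'', b'', h', (hsq _ (one_le_pow₀ hs) ha' hb').imp hpow.trans hpow.trans⟩

lemma tail (hF : f.IsRenormalizationChain (k + 1) F) (hg : f.IsMinimalRenormalization g) :
    g.IsRenormalizationChain k fun i => F (i + 1) :=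
  ⟨(hF.1 ▸ hF.2 0 k.succ_pos).unique hg, fun i hi => hF.2 (i + 1) (Nat.succ_lt_succ hi)⟩

lemma snoc (hF : f.IsRenormalizationChain k F) (hg : (F k).IsMinimalRenormalization g) :
    f.IsRenormalizationChain (k + 1) (Function.update F (k + 1) g) := by
  refine ⟨?_, fun i hi => ?_⟩
  · rw [Function.update_of_ne k.succ_ne_zero.symm, hF.1]
  · rw [Function.update_of_ne hi.ne]
    rcases (Nat.le_of_lt_succ hi).lt_or_eq with hik | rfl
    · rw [Function.update_of_ne (Nat.succ_lt_succ hik).ne]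
      exact hF.2 i hik
    · rwa [Function.update_self]

end IsRenormalizationChain

/-- The slopes of `f` need not exceed `1`, but those of its first renormalization do; from then on
they grow geometrically, while no Lorenz map with constant slopes has both above `2`. -/
theorem IsPwLinear.exists_forall_isRenormalizationChain_le (hf : f.IsPwLinear a b) :
    ∃ N, ∀ k F, f.IsRenormalizationChain k F → k ≤ N := by
  by_cases hex : ∃ g, f.IsMinimalRenormalization g
  · obtain ⟨g, hg⟩ := hex
    have ⟨ℓ, r, hren, _⟩ := hg
    obtain ⟨a', b', hg', ha', hb', -⟩ := hf.exists_isPwLinear_of_isRenormalization hren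
    have hs : 1 < min a' b' := lt_min ha' hb'
    obtain ⟨N, hN⟩ := pow_unbounded_of_one_lt 2 hs
    refine ⟨N, fun k F hF => ?_⟩
    cases k with
    | zero => exact N.zero_le
    | succ k =>
      obtain ⟨a'', b'', hk, ha'', hb''⟩ := (hF.tail hg).pow_le_slope hg' hs.le (min_le_left _ _)
        (min_le_right _ _) k le_rfl
      have hlt : min a' b' ^ (k + 1) < min a' b' ^ N := (hk.slope_le_two ha'' hb'').trans_lt hN
      exact ((pow_lt_pow_iff_right₀ hs).1 hlt).le
  · refine ⟨0, fun k F hF => not_lt.1 fun hk => hex ⟨F 1, ?_⟩⟩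
    simpa only [hF.1, zero_add] using hF.2 0 hk

theorem IsPwLinear.exists_isTimesRenormalizable (hf : f.IsPwLinear a b) :
    ∃ m, f.IsTimesRenormalizable m ∧ ∀ k F, f.IsRenormalizationChain k F → k ≤ m := by
  classical
  obtain ⟨N, hN⟩ := hf.exists_forall_isRenormalizationChain_le
  let HasChain : ℕ → Prop := fun k => ∃ F, f.IsRenormalizationChain k F
  have hzero : HasChain 0 := ⟨fun _ => f, rfl, fun i hi => absurd hi i.not_lt_zero⟩
  have hmax : ∀ k F, f.IsRenormalizationChain k F → k ≤ Nat.findGreatest HasChain N :=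
    fun k F hF => Nat.le_findGreatest (hN k F hF) ⟨F, hF⟩
  obtain ⟨F, hF⟩ := Nat.findGreatest_spec N.zero_le hzero
  refine ⟨_, ⟨F, hF, ?_⟩, hmax⟩
  rintro ⟨ℓ, r, g, hg⟩
  obtain ⟨a', b', hm⟩ := hF.isPwLinear hf _ le_rfl
  obtain ⟨g', hg'⟩ := hm.exists_isMinimalRenormalization hg
  exact (hmax _ _ (hF.snoc hg')).not_gt (Nat.lt_succ_self _)

/-! ### The dichotomy -/

lemma IsPwLinear.exists_isMinPeriodOrbit (hf : f.IsPwLinear a b) : ∃ O, f.IsMinPeriodOrbit O := by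
  obtain ⟨x, hx, hmin⟩ := exists_minimalFor_of_wellFoundedLT f.IsPeriodicPoint
    (Function.minimalPeriod f.map) hf.exists_isPeriodicPoint
  exact ⟨_, x, hx, rfl, fun y hy => (le_total _ _).elim id (hmin hy)⟩

lemma IsInvariantCycle.minimalRenormalizationIsPeriodic (hX : f.IsInvariantCycle X)
    (hf : f.IsPwLinear a b) : f.MinimalRenormalizationIsPeriodic := by
  obtain ⟨O, hO⟩ := hf.exists_isMinPeriodOrbit
  obtain rfl := hX.eq_of_isMinPeriodOrbit hf.isExpanding hO
  exact ⟨O, hO, fun O' hO' => hX.eq_of_isMinPeriodOrbit hf.isExpanding hO',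
    hX.isMinimalCompletelyInvariant hf⟩

theorem IsPwLinear.minimalRenormalizationIsPeriodic (hf : f.IsPwLinear a b)
    (hg : f.IsMinimalRenormalization g) : f.MinimalRenormalizationIsPeriodic := by
  obtain ⟨ℓ, r, hg, -⟩ := hg
  obtain ⟨E, hE, -⟩ := hg.exists_isProperCompletelyInvariant
  obtain ⟨X, -, hX⟩ := hf.exists_isInvariantCycle hE
  exact hX.minimalRenormalizationIsPeriodic hf

lemma IsMinPeriodOrbit.map_mem (hO : f.IsMinPeriodOrbit O) (hz : z ∈ O) : f.map z ∈ O := by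
  obtain ⟨x, -, rfl, -⟩ := hO
  obtain ⟨i, rfl⟩ := hz
  exact ⟨i + 1, Function.iterate_succ_apply' _ _ _⟩

lemma IsMinPeriodOrbit.nonempty_inter_Ioo (hO : f.IsMinPeriodOrbit O) (hf : f.IsLorenz)
    (hnt : O.Nontrivial) : (O ∩ Ioo f.left f.right).Nonempty := by
  obtain ⟨x, hx, rfl, -⟩ := hO
  exact hf.nonempty_inter_Ioo_of_nontrivial_orbit hx.1 hnt

theorem IsPwLinear.dichotomy (hf : f.IsPwLinear a b) :
    ∃ D, f.IsMinimalCompletelyInvariant D ∧ ∀ O, f.IsMinPeriodOrbit O →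
      (O.Nontrivial → D = f.preimageClosure O) ∧ (D = O ∨ D = Icc f.left f.right) := by
  by_cases hex : ∃ E, f.IsProperCompletelyInvariant E
  · obtain ⟨E, hE⟩ := hex
    obtain ⟨X, -, hX⟩ := hf.exists_isInvariantCycle hE
    refine ⟨X, hX.isMinimalCompletelyInvariant hf, fun O hO => ?_⟩
    obtain rfl := hX.eq_of_isMinPeriodOrbit hf.isExpanding hO
    exact ⟨fun _ => (hX.preimageClosure_eq hf.toIsLorenz).symm, Or.inl rfl⟩
  · have hno := not_exists.1 hex
    refine ⟨Icc f.left f.right, ⟨Or.inl rfl, ?_⟩, fun O hO => ⟨fun hnt => ?_, Or.inr rfl⟩⟩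
    · rintro E (rfl | hE)
      · exact Subset.rfl
      · exact absurd hE (hno E)
    · exact (hf.isExpanding.preimageClosure_eq_Icc hf.overlap hno (fun _ => hO.map_mem)
        (hO.nonempty_inter_Ioo hf.toIsLorenz hnt)).symm

lemma isPwLinear_pwLinear {a b c : ℝ} (hf : (pwLinear a b c).IsLorenz)
    (havg : 1 < a * c + b * (1 - c)) : (pwLinear a b c).IsPwLinear a b where
  toIsLorenz := hf
  map_of_lt x hx := by
    simp only [pwLinear] at hx ⊢
    rw [if_pos hx.2]
    ring
  map_of_gt x hx := by
    simp only [pwLinear] at hx ⊢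
    rw [if_neg hx.1.le.not_gt]
    ring
  overlap := by
    have hleft : (pwLinear a b c).map 0 = a * 0 + 1 - a * c := if_pos hf.left_lt
    have hright : (pwLinear a b c).map 1 = b * (1 - c) := if_neg hf.lt_right.le.not_gt
    change (pwLinear a b c).map 0 < (pwLinear a b c).map 1
    rw [hleft, hright]
    linarith

end Renormalization

end LorenzData

theorem mainTheorem2 (a b c : ℝ) (hf : (LorenzData.pwLinear a b c).IsLorenz)
    (havg : 1 < a * c + b * (1 - c)) :
    (∃ m, (LorenzData.pwLinear a b c).IsTimesRenormalizable m ∧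
      ∀ k F, (LorenzData.pwLinear a b c).IsRenormalizationChain k F → k ≤ m) ∧
    (∀ k F, (LorenzData.pwLinear a b c).IsRenormalizationChain k F →
      ∀ i < k, (F i).MinimalRenormalizationIsPeriodic) ∧
    (∃ O, (LorenzData.pwLinear a b c).IsMinPeriodOrbit O) ∧
    ∃ D, (LorenzData.pwLinear a b c).IsMinimalCompletelyInvariant D ∧
      ∀ O, (LorenzData.pwLinear a b c).IsMinPeriodOrbit O →
        (O.Nontrivial → D = (LorenzData.pwLinear a b c).preimageClosure O) ∧
        (D = O ∨ D = Icc 0 1) := by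
  have hpw := LorenzData.isPwLinear_pwLinear hf havg
  refine ⟨hpw.exists_isTimesRenormalizable, fun k F hF i hi => ?_,
    hpw.exists_isMinPeriodOrbit, hpw.dichotomy⟩
  obtain ⟨a', b', h⟩ := hF.isPwLinear hpw i hi.le
  exact h.minimalRenormalizationIsPeriodic (hF.2 i hi)
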